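/- A semigroup variety is the class of all semigroups satisfying some set of identities, and $\mathbf{SEM}$ is the lattice of all semigroup varieties ordered by inclusion ($\wedge$ is intersection, $\mathbf X\vee\mathbf Y$ is the least variety containing $\mathbf X$ and $\mathbf Y$). An element $x$ of a lattice $L$ is called modular if $(x\vee y)\wedge z=(x\wedge z)\vee y$ for all $y,z\in L$ with $y\le z$. A permutational identity of length $3$ is an identity $x_1x_2x_3\approx x_{\pi(1)}x_{\pi(2)}x_{\pi(3)}$ where $\pi$ is a non-trivial permutation of $\{1,2,3\}$. For a semigroup word $\mathbf u$, the expression $\mathbf u\approx 0$ abbreviates the pair of identities $x\mathbf u\approx\mathbf u x\approx\mathbf u$, where $x$ is a letter not occurring in $\mathbf u$. Let $\mathbf T$ be the trivial semigroup variety and $\mathbf{SL}$ the variety of all semilattices. Theorem. Let $\mathbf V$ be a semigroup variety satisfying a permutational identity of length $3$. Then $\mathbf V$ is a modular element of the lattice $\mathbf{SEM}$ if and only if $\mathbf V=\mathbf M\vee\mathbf N$ for some semigroup varieties $\mathbf M$ and $\mathbf N$ such that $\mathbf M$ is one of the varieties $\mathbf T$ or $\mathbf{SL}$, while $\mathbf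 N$ satisfies one of the following identity systems: \begin{align*} &xyz\approx zyx,\ x^2y\approx 0;\\ &xyz\approx yzx,\ x^2y\approx 0;\\ &xyz\approx yxz,\ xyzt\approx xzty,\ xy^2\approx 0;\\ &xyz\approx xzy,\ xyzt\approx yzxt,\ x^2y\approx 0. \end{align*} -/

import Mathlib

universe u

/-- An element `x` of a lattice is *modular* if `(x ⊔ y) ⊓ z = (x ⊓ z) ⊔ y` for all `y ≤ z`. -/
def IsModularElement {L : Type*} [Lattice L] (x : L) : Prop :=
  ∀ y z : L, y ≤ z → (x ⊔ y) ⊓ z = (x ⊓ z) ⊔ y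

/-- Semigroup words over a countably infinite alphabet: the free semigroup on `ℕ`. -/
abbrev SWord : Type := FreeSemigroup ℕ

namespace SWord

/-- The one-letter words. -/
abbrev letter (i : ℕ) : SWord := FreeSemigroup.of i

/-- The (nonempty) list of letters of a word, from left to right. -/
def letters (w : SWord) : List ℕ := w.head :: w.tail

end SWord

/-- A semigroup identity `lhs ≈ rhs`. -/
structure SIdentity where
  lhs : SWord
  rhs : SWord

/-- `u ≈≈ v` is the identity with the left-hand side `u` and the right-hand side `v`. -/
infix:50 " ≈≈ " => SIdentity.mk

namespace SIdentity

/-- An identity holds in a semigroup if both sides take the same value under every assignment of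
elements of the semigroup to the letters. -/
def HoldsIn (e : SIdentity) (S : Type u) [Semigroup S] : Prop :=
  ∀ φ : ℕ → S, FreeSemigroup.lift φ e.lhs = FreeSemigroup.lift φ e.rhs

/-- Permutational identities of length `n`: the identities `x₁x₂⋯xₙ ≈ x_{π1}x_{π2}⋯x_{πn}` with `π`
a nontrivial permutation. The letters are numbered from `0`. -/
def IsPermutational (n : ℕ) (e : SIdentity) : Prop :=
  ∃ π : Equiv.Perm (Fin n), π ≠ 1 ∧
    e.lhs.letters = List.ofFn (fun i : Fin n => (i : ℕ)) ∧
    e.rhs.letters = List.ofFn (fun i : Fin n => (π i : ℕ))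

end SIdentity

/-- The identity system abbreviated as `w ≈ 0`: the identities `xw ≈ w` and `wx ≈ w`, where `x` is
a letter that does not occur in `w`. -/
def zeroIdentities (w : SWord) : Set SIdentity :=
  {e | ∃ i : ℕ, i ∉ w.letters ∧
    (e = (SWord.letter i * w ≈≈ w) ∨ e = (w * SWord.letter i ≈≈ w))}

/-- A semigroup variety: a class of semigroups that consists of all semigroups satisfying some
set of identities. -/
@[ext]
structure SemigroupVariety where
  Mem : ∀ (S : Type u) [Semigroup S], Prop
  equational : ∃ E : Set SIdentity, ∀ (S : Type u) [Semigroup S],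
    Mem S ↔ ∀ e ∈ E, e.HoldsIn S

namespace SemigroupVariety

/-- The variety given by a set of identities. -/
def var (E : Set SIdentity) : SemigroupVariety.{u} where
  Mem S _ := ∀ e ∈ E, e.HoldsIn S
  equational := ⟨E, fun _ _ => Iff.rfl⟩

/-- A variety satisfies an identity if the identity holds in all its members. -/
def Satisfies (V : SemigroupVariety.{u}) (e : SIdentity) : Prop :=
  ∀ (S : Type u) [Semigroup S], V.Mem S → e.HoldsIn S

/-- A variety satisfies an identity system if it satisfies each identity of the system. -/
def SatisfiesAll (V : SemigroupVariety.{u}) (E : Set SIdentity) : Prop :=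
  ∀ e ∈ E, V.Satisfies e

/-- Varieties are ordered by inclusion of classes. -/
instance : PartialOrder SemigroupVariety.{u} where
  le V W := ∀ (S : Type u) [Semigroup S], V.Mem S → W.Mem S
  le_refl _ _ _ h := h
  le_trans _ _ _ h₁ h₂ S _ h := h₂ S (h₁ S h)
  le_antisymm V W h₁ h₂ := by
    ext S inst
    exact ⟨h₁ S, h₂ S⟩

/-- The lattice of all semigroup varieties: the meet of two varieties is their intersection, and
the join of two varieties is the least variety containing both, that is, the variety given by all
identities that hold in both. -/
instance : Lattice SemigroupVariety.{u} where
  inf V W :=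
    { Mem := fun S _ => V.Mem S ∧ W.Mem S
      equational := by
        obtain ⟨E, hE⟩ := V.equational
        obtain ⟨F, hF⟩ := W.equational
        refine ⟨E ∪ F, fun S _ => ?_⟩
        rw [hE, hF]
        constructor
        · rintro ⟨h₁, h₂⟩ e (he | he)
          · exact h₁ e he
          · exact h₂ e he
        · exact fun h => ⟨fun e he => h e (Or.inl he), fun e he => h e (Or.inr he)⟩ }
  inf_le_left _ _ _ _ h := h.1
  inf_le_right _ _ _ _ h := h.2
  le_inf _ _ _ h₁ h₂ S _ h := ⟨h₁ S h, h₂ S h⟩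
  sup V W := var {e | V.Satisfies e ∧ W.Satisfies e}
  le_sup_left _ _ S _ h _ he := he.1 S h
  le_sup_right _ _ S _ h _ he := he.2 S h
  sup_le V W U h₁ h₂ S _ h := by
    obtain ⟨E, hE⟩ := U.equational
    refine (hE S).2 fun e he => h e ⟨?_, ?_⟩
    · exact fun A _ hA => (hE A).1 (h₁ A hA) e he
    · exact fun A _ hA => (hE A).1 (h₂ A hA) e he

open SWord in
/-- The trivial variety `T`, given by `x ≈ y`. -/
def trivialVariety : SemigroupVariety.{u} := var {letter 0 ≈≈ letter 1}

open SWord in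
/-- The variety `SL` of all semilattices, that is, of all commutative idempotent semigroups. -/
def semilatticeVariety : SemigroupVariety.{u} :=
  var {letter 0 * letter 0 ≈≈ letter 0, letter 0 * letter 1 ≈≈ letter 1 * letter 0}

end SemigroupVariety

section Systems

open SWord

/-- `xyz ≈ zyx`, `x²y ≈ 0`. -/
def identitySystem1 : Set SIdentity :=
  let x := letter 0; let y := letter 1; let z := letter 2
  {x * y * z ≈≈ z * y * x} ∪ zeroIdentities (x * x * y)

/-- `xyz ≈ yzx`, `x²y ≈ 0`. -/
def identitySystem2 : Set SIdentity :=
  let x := letter 0; let y := letter 1; let z := letter 2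
  {x * y * z ≈≈ y * z * x} ∪ zeroIdentities (x * x * y)

/-- `xyz ≈ yxz`, `xyzt ≈ xzty`, `xy² ≈ 0`. -/
def identitySystem3 : Set SIdentity :=
  let x := letter 0; let y := letter 1; let z := letter 2; let t := letter 3
  {x * y * z ≈≈ y * x * z, x * y * z * t ≈≈ x * z * t * y} ∪ zeroIdentities (x * y * y)

/-- `xyz ≈ xzy`, `xyzt ≈ yzxt`, `x²y ≈ 0`. -/
def identitySystem4 : Set SIdentity :=
  let x := letter 0; let y := letter 1; let z := letter 2; let t := letter 3
  {x * y * z ≈≈ x * z * y, x * y * z * t ≈≈ y * z * x * t} ∪ zeroIdentities (x * x * y)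

end Systems

/-! Sending a variety to its identities turns SEM upside down into the lattice of fully invariant
congruences on the free semigroup. The modular law is self-dual, so the question is when the theory
`c` of `V` satisfies `(c ⊔ g) ⊓ b ≤ (c ⊓ b) ⊔ g` for all fully invariant `g ≤ b`.

Sufficiency. Each of the four systems identifies words of length at least 4 that are rearrangements
of each other and annihilates those with a repeated letter; the only other words with a repeated
letter that may be nonzero are squares of letters and the renamings of one word of length 3
(`IsNilPermutative`). Along a chain of `c`- and `g`-steps, either all words are `g`-related to zero,
and zero gives the required detour, or all are renamings of the first one. In the second case the
law concerns subgroups of the symmetric group on the content: for length at least 4, `c` contains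
every rearrangement, and for at most three letters the subgroup lattice is modular. Joining with SL
means intersecting `c` with equality of content, which preserves modularity
(`IsModularFIC.inf_contentCon`).

Necessity. Modularity acts as an exchange principle (`IsModularFIC.exists_rel`): if a chain of `c`-
and `g`-steps between `b`-related words leaves a `g`-closed set, then some single step of `c ⊓ b`
leaves it. Suitable pairs `g ≤ b` yield all permutational identities of length 4 (automatic unless
the given one is an adjacent transposition), then `x²yz ≈ xy²z`, then an identity equating a word
`u` of length 3 having a repeated letter with a longer word of the same content. Hence `c`
identifies words of equal content in the ideal `repeatIdeal u`. If `V` does not contain SL, the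
whole ideal collapses and `V` satisfies `u ≈ 0`; otherwise `V` is the join of SL and its subvariety
in which the ideal is zero. -/

open SWord

/-! ### Words, letters and substitutions. -/

namespace SWord

theorem letters_mul (u v : SWord) : (u * v).letters = u.letters ++ v.letters := rfl

@[simp] theorem letters_letter (i : ℕ) : (letter i).letters = [i] := rfl

theorem letters_injective : Function.Injective letters := by
  rintro ⟨a, l⟩ ⟨b, m⟩ h
  simpa [letters] using h

theorem letters_ne_nil (w : SWord) : w.letters ≠ [] := by simp [letters]

theorem exists_letters {l : List ℕ} (h : l ≠ []) : ∃ w : SWord, w.letters = l := by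
  cases l with
  | nil => exact absurd rfl h
  | cons a l => exact ⟨⟨a, l⟩, rfl⟩

@[elab_as_elim]
theorem inductionOn {P : SWord → Prop} (w : SWord) (letter : ∀ i, P (letter i))
    (mul : ∀ i v, P v → P (SWord.letter i * v)) : P w :=
  FreeSemigroup.recOnMul w letter fun i v _ hv => mul i v hv

/-- Substitution of words for the letters. -/
abbrev subst (φ : ℕ → SWord) : SWord →ₙ* SWord := FreeSemigroup.lift φ

@[simp] theorem subst_letter (φ : ℕ → SWord) (i : ℕ) : subst φ (letter i) = φ i := rfl

theorem letters_subst (φ : ℕ → SWord) (w : SWord) :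
    (subst φ w).letters = w.letters.flatMap fun i => (φ i).letters := by
  induction w using inductionOn with
  | letter i => simp
  | mul i v ih => simp only [map_mul, letters_mul, ih]; simp

theorem subst_subst (φ ψ : ℕ → SWord) (w : SWord) :
    subst φ (subst ψ w) = subst (fun i => subst φ (ψ i)) w := by
  induction w using inductionOn with
  | letter i => rfl
  | mul i v ih => simp only [map_mul, ih]; rfl

theorem lift_subst {S : Type*} [Semigroup S] (f : ℕ → S) (φ : ℕ → SWord) (w : SWord) :
    FreeSemigroup.lift f (subst φ w) = FreeSemigroup.lift (fun i => FreeSemigroup.lift f (φ i)) w := by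
  induction w using inductionOn with
  | letter i => rfl
  | mul i v ih => simp only [map_mul, ih]; rfl

theorem subst_congr {φ ψ : ℕ → SWord} {w : SWord} (h : ∀ i ∈ w.letters, φ i = ψ i) :
    subst φ w = subst ψ w := by
  induction w using inductionOn with
  | letter i => exact h i (by simp)
  | mul i v ih =>
    rw [map_mul, map_mul, ih fun j hj => h j (by simp [letters_mul, hj]), subst_letter,
      subst_letter, h i (by simp [letters_mul])]

theorem subst_id (w : SWord) : subst letter w = w := by
  induction w using inductionOn with
  | letter i => rfl
  | mul i v ih => rw [map_mul, ih]; rfl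

end SWord

/-! ### Varieties and fully invariant congruences. -/

/-- A congruence on the free semigroup is fully invariant if it is stable under substitutions. -/
def FullyInvariant (c : Con SWord) : Prop :=
  ∀ (φ : ℕ → SWord) {u v : SWord}, c u v → c (subst φ u) (subst φ v)

/-- Each single step survives multiplication on either side, so the transitive closure of the steps
is already a congruence. -/
theorem Con.sup_rel_iff {M : Type*} [Mul M] {c d : Con M} {a b : M} :
    (c ⊔ d) a b ↔ Relation.ReflTransGen (fun x y => c x y ∨ d x y) a b := by
  let r : M → M → Prop := fun x y => c x y ∨ d x y
  have hr : ∀ {x y}, r x y → r y x := fun h => h.imp c.symm d.symm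
  have hsymm : ∀ {x y}, Relation.ReflTransGen r x y → Relation.ReflTransGen r y x := by
    intro x y h
    induction h with
    | refl => exact .refl
    | tail _ h ih => exact .head (hr h) ih
  let e : Con M :=
    { r := Relation.ReflTransGen r
      iseqv := ⟨fun _ => .refl, hsymm, .trans⟩
      mul' := by
        intro w x y z h₁ h₂
        have h₃ : Relation.ReflTransGen r (w * y) (x * y) :=
          h₁.lift (· * y) fun a b h => h.imp (fun h => c.mul h (c.refl y)) fun h => d.mul h (d.refl y)
        have h₄ : Relation.ReflTransGen r (x * y) (x * z) :=
          h₂.lift (x * ·) fun a b h => h.imp (fun h => c.mul (c.refl x) h) fun h => d.mul (d.refl x) h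
        exact h₃.trans h₄ }
  have he : c ⊔ d ≤ e :=
    sup_le (fun _ _ h => .single (Or.inl h)) fun _ _ h => .single (Or.inr h)
  constructor
  · exact fun h => he h
  · intro h
    induction h with
    | refl => exact (c ⊔ d).refl _
    | tail _ h ih =>
      refine (c ⊔ d).trans ih ?_
      rcases h with h | h
      · exact (le_sup_left : c ≤ c ⊔ d) h
      · exact (le_sup_right : d ≤ c ⊔ d) h

namespace FullyInvariant

theorem sup {c d : Con SWord} (hc : FullyInvariant c) (hd : FullyInvariant d) :
    FullyInvariant (c ⊔ d) := by
  intro φ u v h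
  rw [Con.sup_rel_iff] at h ⊢
  exact h.lift _ fun a b h => h.imp (fun h => hc φ h) fun h => hd φ h

theorem inf {c d : Con SWord} (hc : FullyInvariant c) (hd : FullyInvariant d) :
    FullyInvariant (c ⊓ d) := fun φ _ _ h => ⟨hc φ h.1, hd φ h.2⟩

end FullyInvariant

/-- Modularity of an element of the lattice of fully invariant congruences. -/
def IsModularFIC (c : Con SWord) : Prop :=
  ∀ g b : Con SWord, FullyInvariant g → FullyInvariant b → g ≤ b → (c ⊔ g) ⊓ b ≤ (c ⊓ b) ⊔ g

namespace SemigroupVariety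

/-- The fully invariant congruence formed by the identities of a variety. -/
def eqTheory (V : SemigroupVariety.{u}) : Con SWord where
  r u v := V.Satisfies (u ≈≈ v)
  iseqv := ⟨fun _ _ _ _ _ => rfl, fun h S _ hS φ => (h S hS φ).symm,
    fun h k S _ hS φ => (h S hS φ).trans (k S hS φ)⟩
  mul' := by
    intro w x y z h k S _ hS φ
    have h' := h S hS φ
    have k' := k S hS φ
    simp only [map_mul] at h' k' ⊢
    rw [h', k']

theorem fullyInvariant_eqTheory (V : SemigroupVariety.{u}) : FullyInvariant V.eqTheory := by
  intro φ u v h S _ hS f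
  simp only [lift_subst]
  exact h S hS _

/-- The variety defined by the identities of a congruence. -/
def ofCon (c : Con SWord) : SemigroupVariety.{u} := var {e | c e.lhs e.rhs}

/-- The quotient by `c` belongs to the variety by full invariance, and evaluating there at the
classes of the letters separates words that `c` does not relate. `ULift` only adjusts the universe.
-/
theorem eqTheory_ofCon {c : Con SWord} (hc : FullyInvariant c) :
    (ofCon.{u} c).eqTheory = c := by
  ext u v
  constructor
  · intro h
    let S : Type u := ULift.{u} c.Quotient
    let f : SWord →ₙ* S := ⟨fun w => ⟨(w : c.Quotient)⟩, fun _ _ => rfl⟩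
    have hf : ∀ (φ : ℕ → SWord) (w : SWord), FreeSemigroup.lift (fun i => f (φ i)) w = f (subst φ w) := by
      intro φ w
      induction w using SWord.inductionOn with
      | letter i => rfl
      | mul i v ih => simp only [map_mul, ih]; rfl
    have hS : (ofCon.{u} c).Mem S := by
      rintro ⟨a, b⟩ hab φ
      obtain ⟨ψ, hψ⟩ : ∃ ψ : ℕ → SWord, φ = fun i => f (ψ i) := by
        choose ψ hψ using fun i => Quotient.exists_rep (φ i).down
        exact ⟨ψ, funext fun i => ULift.ext _ _ (hψ i).symm⟩
      subst hψ
      rw [hf, hf]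
      exact ULift.ext _ _ ((Con.eq c).2 (hc ψ hab))
    have := h S hS fun i => f (letter i)
    rw [hf, hf] at this
    simp only [SWord.subst_id] at this
    exact (Con.eq c).1 (congrArg ULift.down this)
  · exact fun h S _ hS => hS (u ≈≈ v) h

theorem ofCon_eqTheory (V : SemigroupVariety.{u}) : ofCon V.eqTheory = V := by
  apply le_antisymm
  · intro S _ h
    obtain ⟨E, hE⟩ := V.equational
    exact (hE S).2 fun e he => h e fun A _ hA => (hE A).1 hA e he
  · exact fun S _ h e he => he S h

theorem eqTheory_le_iff {V W : SemigroupVariety.{u}} : W.eqTheory ≤ V.eqTheory ↔ V ≤ W := by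
  constructor
  · intro h S _ hS
    rw [← ofCon_eqTheory W]
    exact fun e he => h he S hS
  · exact fun h u v huv S _ hS => huv S (h S hS)

theorem eqTheory_injective : Function.Injective (eqTheory.{u}) := fun _ _ h =>
  le_antisymm (eqTheory_le_iff.1 h.ge) (eqTheory_le_iff.1 h.le)

theorem eqTheory_sup (V W : SemigroupVariety.{u}) :
    (V ⊔ W).eqTheory = V.eqTheory ⊓ W.eqTheory := by
  apply le_antisymm
  · exact le_inf (eqTheory_le_iff.2 le_sup_left) (eqTheory_le_iff.2 le_sup_right)
  · exact fun u v h S _ hS => hS (u ≈≈ v) h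

theorem eqTheory_inf (V W : SemigroupVariety.{u}) :
    (V ⊓ W).eqTheory = V.eqTheory ⊔ W.eqTheory := by
  have hfi := V.fullyInvariant_eqTheory.sup W.fullyInvariant_eqTheory
  apply le_antisymm
  · rw [← eqTheory_ofCon.{u} hfi, eqTheory_le_iff]
    refine le_inf ?_ ?_
    · rw [← eqTheory_le_iff, eqTheory_ofCon hfi]; exact le_sup_left
    · rw [← eqTheory_le_iff, eqTheory_ofCon hfi]; exact le_sup_right
  · exact sup_le (eqTheory_le_iff.2 inf_le_left) (eqTheory_le_iff.2 inf_le_right)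

/-- Passing to theories exchanges joins and meets and the roles of `y` and `z`. One inclusion of the
modular law holds in every lattice, so `IsModularFIC` asks only for the other. -/
theorem isModularElement_iff (V : SemigroupVariety.{u}) :
    IsModularElement V ↔ IsModularFIC V.eqTheory := by
  constructor
  · intro h g b hg hb hgb
    have := congrArg eqTheory (h (ofCon b) (ofCon g)
      (by rwa [← eqTheory_le_iff, eqTheory_ofCon hg, eqTheory_ofCon hb]))
    rw [eqTheory_inf, eqTheory_sup, eqTheory_sup, eqTheory_inf, eqTheory_ofCon hg,
      eqTheory_ofCon hb] at this
    exact this.ge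
  · intro h y z hyz
    apply eqTheory_injective
    rw [eqTheory_inf, eqTheory_sup, eqTheory_sup, eqTheory_inf]
    have hzy := eqTheory_le_iff.2 hyz
    apply le_antisymm
    · exact sup_le (inf_le_inf_right _ le_sup_left) (le_inf le_sup_right hzy)
    · exact h _ _ (fullyInvariant_eqTheory z) (fullyInvariant_eqTheory y) hzy

end SemigroupVariety

/-! ### Content of words and the theory of semilattices. -/

namespace SWord

/-- The set of letters of a word. -/
def content (w : SWord) : Finset ℕ := w.letters.toFinset

theorem mem_content {w : SWord} {i : ℕ} : i ∈ w.content ↔ i ∈ w.letters := List.mem_toFinset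

@[simp] theorem content_letter (i : ℕ) : (letter i).content = {i} := rfl

@[simp] theorem content_mul (u v : SWord) : (u * v).content = u.content ∪ v.content := by
  simp [content, letters_mul]

theorem mem_content_subst {φ : ℕ → SWord} {w : SWord} {x : ℕ} :
    x ∈ (subst φ w).content ↔ ∃ i ∈ w.content, x ∈ (φ i).content := by
  simp [content, letters_subst]

theorem head_mem_content (w : SWord) : w.head ∈ w.content := by simp [content, letters]

theorem letters_length_pos (w : SWord) : 0 < w.letters.length := by simp [letters]

theorem length_le_subst (φ : ℕ → SWord) (w : SWord) :
    w.letters.length ≤ (subst φ w).letters.length := by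
  induction w using inductionOn with
  | letter i => exact letters_length_pos _
  | mul i v ih =>
    have := (φ i).letters_length_pos
    simp only [map_mul, letters_mul, List.length_append, letters_letter, List.length_singleton,
      subst_letter]
    omega

theorem subst_rel {c : Con SWord} {φ ψ : ℕ → SWord} (w : SWord)
    (h : ∀ i ∈ w.content, c (φ i) (ψ i)) : c (subst φ w) (subst ψ w) := by
  induction w using inductionOn with
  | letter i => exact h i (by simp)
  | mul i v ih =>
    simp only [map_mul]
    exact c.mul (h i (by simp)) (ih fun j hj => h j (by simp [hj]))

/-- The congruence of having the same content. -/
def contentCon : Con SWord where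
  r u v := u.content = v.content
  iseqv := ⟨fun _ => rfl, fun h => h.symm, fun h k => h.trans k⟩
  mul' h k := by simp only [content_mul, h, k]

theorem contentCon_iff {u v : SWord} : contentCon u v ↔ u.content = v.content := Iff.rfl

theorem fullyInvariant_contentCon : FullyInvariant contentCon := by
  intro φ u v h
  rw [contentCon_iff] at h ⊢
  ext x
  rw [mem_content_subst, mem_content_subst, h]

end SWord

theorem SemigroupVariety.eqTheory_semilatticeVariety :
    semilatticeVariety.{u}.eqTheory = contentCon := by
  apply le_antisymm
  · rw [← eqTheory_ofCon.{u} fullyInvariant_contentCon, eqTheory_le_iff]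
    intro S _ hS e he
    refine hS e ?_
    rcases he with rfl | rfl <;> simp [contentCon_iff, Finset.union_comm]
  · intro a b hab S _ hS φ
    have idem : ∀ x : S, x * x = x := fun x => hS _ (Or.inl rfl) fun _ => x
    have comm : ∀ x y : S, x * y = y * x := fun x y => by
      simpa using hS _ (Or.inr rfl) fun i => if i = 0 then x else y
    -- In a semilattice a factor that is already present is absorbed, so two words of equal content
    -- absorb each other.
    have absorb : ∀ (w : SWord) (i : ℕ), i ∈ w.content →
        φ i * FreeSemigroup.lift φ w = FreeSemigroup.lift φ w := by
      intro w i
      induction w using SWord.inductionOn with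
      | letter j =>
        intro h
        obtain rfl : i = j := by simpa using h
        exact idem _
      | mul j v ih =>
        intro h
        rw [content_mul, Finset.mem_union] at h
        rw [map_mul]
        rcases h with h | h
        · obtain rfl : i = j := by simpa using h
          rw [← mul_assoc]
          exact congrArg (· * _) (idem _)
        · rw [← mul_assoc, comm (φ i), mul_assoc, ih h]
    have absorb' : ∀ v w : SWord, v.content ⊆ w.content →
        FreeSemigroup.lift φ v * FreeSemigroup.lift φ w = FreeSemigroup.lift φ w := by
      intro v w
      induction v using SWord.inductionOn with
      | letter j => exact fun h => absorb w j (h (by simp))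
      | mul j v ih =>
        intro h
        rw [content_mul] at h
        rw [map_mul, mul_assoc, ih (Finset.union_subset_right h)]
        exact absorb w j (h (by simp))
    have h₁ := absorb' a b (by rw [contentCon_iff.1 hab])
    have h₂ := absorb' b a (by rw [contentCon_iff.1 hab])
    show FreeSemigroup.lift φ a = FreeSemigroup.lift φ b
    rw [← h₂, comm, h₁]

/-! ### Fully invariant ideals, and joins with SL. -/

/-- A fully invariant ideal of the free semigroup. -/
structure IsFIIdeal (I : Set SWord) : Prop where
  mul_left : ∀ {a : SWord} (b : SWord), a ∈ I → b * a ∈ I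
  mul_right : ∀ {a : SWord} (b : SWord), a ∈ I → a * b ∈ I
  subst : ∀ {a : SWord} (φ : ℕ → SWord), a ∈ I → subst φ a ∈ I

theorem IsFIIdeal.subst_mem_of_letter {I : Set SWord} (hI : IsFIIdeal I) {φ : ℕ → SWord} {w : SWord}
    {i : ℕ} (hi : i ∈ w.content) (h : φ i ∈ I) : SWord.subst φ w ∈ I := by
  induction w using SWord.inductionOn with
  | letter j =>
    obtain rfl : i = j := by simpa using hi
    exact h
  | mul j v ih =>
    rw [map_mul]
    rw [content_mul, Finset.mem_union] at hi
    rcases hi with hi | hi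
    · obtain rfl : i = j := by simpa using hi
      exact hI.mul_right _ h
    · exact hI.mul_left _ (ih hi)

/-- If a modular fully invariant congruence relates words of different content only within one
class, then its intersection with the congruence of equal content is modular. -/
theorem IsModularFIC.inf_contentCon {c : Con SWord} {I : Set SWord} (hI : IsFIIdeal I)
    (hrel : ∀ a ∈ I, ∀ b ∈ I, c a b)
    (hcon : ∀ a b, c a b → a.content = b.content ∨ a ∈ I ∧ b ∈ I)
    (hm : IsModularFIC c) : IsModularFIC (c ⊓ contentCon) := by
  intro g b hg hb hgb u v ⟨h₁, h₂⟩
  have h₁' : (c ⊔ g) u v := (sup_le_sup_right inf_le_left g : c ⊓ contentCon ⊔ g ≤ c ⊔ g) h₁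
  by_cases hgs : g ≤ contentCon
  · have hσ : contentCon u v := (sup_le inf_le_right hgs : c ⊓ contentCon ⊔ g ≤ contentCon) h₁
    -- When `g` preserves content, `b` can be cut down to content-preserving pairs, and modularity
    -- of `c` applies to the smaller congruence.
    have := hm g (b ⊓ contentCon) hg (hb.inf fullyInvariant_contentCon) (le_inf hgb hgs)
      ⟨h₁', h₂, hσ⟩
    rw [Con.sup_rel_iff] at this ⊢
    exact Relation.ReflTransGen.mono
      (fun x y h => h.imp (fun h => ⟨⟨h.1, h.2.2⟩, h.2.1⟩) id) _ _ this
  · obtain ⟨p, q, x, hpq, hxp, hxq⟩ : ∃ p q x, g p q ∧ x ∈ p.content ∧ x ∉ q.content := by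
      by_contra! H
      refine hgs fun p q hpq => ?_
      exact Finset.Subset.antisymm (fun x => H p q x hpq) (fun x => H q p x (g.symm hpq))
    set T := c ⊓ contentCon ⊓ b ⊔ g with hT
    have stepT : ∀ {a d : SWord}, a ∈ I → d ∈ I → b a d → a.content = d.content → T a d :=
      fun ha hd h h' => (le_sup_left : c ⊓ contentCon ⊓ b ≤ T) ⟨⟨hrel _ ha _ hd, h'⟩, h⟩
    have gT : ∀ {a d : SWord}, g a d → T a d := fun h => (le_sup_right : g ≤ T) h
    have key : ∀ {a d : SWord}, a ∈ I → d ∈ I → b a d → d.content ⊆ a.content → T a d := by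
      intro a d ha hd had hda
      by_cases hne : a.content ⊆ d.content
      · exact stepT ha hd had (Finset.Subset.antisymm hne hda)
      obtain ⟨y, hya, hyd⟩ := Finset.not_subset.1 hne
      let t := d.head
      have ht : t ∈ d.content := d.head_mem_content
      -- Under `ψ` the word `q` becomes a power of `t`, while `p` acquires all letters of `a`.
      -- Putting these images in place of the letters of `a` missing from `d` gives two `g`-related
      -- words of the ideal, one with the content of `d`, the other with that of `a`.
      let ψ : ℕ → SWord := fun j => if j = x then a else letter t
      have hψq : SWord.subst ψ q = SWord.subst (fun _ => letter t) q := by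
        refine subst_congr fun i hi => if_neg ?_
        rintro rfl
        exact hxq (mem_content.2 hi)
      let φ₀ : ℕ → SWord := fun i => if i ∈ d.content then letter i else SWord.subst ψ q
      let φ₁ : ℕ → SWord := fun i => if i ∈ d.content then letter i else SWord.subst ψ p
      have hg' : g (SWord.subst φ₁ a) (SWord.subst φ₀ a) := by
        refine subst_rel a fun i _ => ?_
        simp only [φ₀, φ₁]
        split_ifs
        · exact g.refl _
        · exact hg ψ hpq
      have hd₀ : SWord.subst φ₀ d = d := by
        rw [subst_congr (ψ := letter) fun i hi => if_pos (mem_content.2 hi), subst_id]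
      have hb₀ : b (SWord.subst φ₀ a) d := by
        have := hb φ₀ had
        rwa [hd₀] at this
      have hc₀ : (SWord.subst φ₀ a).content = d.content := by
        ext z
        rw [mem_content_subst]
        constructor
        · rintro ⟨i, -, hz⟩
          by_cases hi : i ∈ d.content
          · simp only [φ₀, if_pos hi, content_letter, Finset.mem_singleton] at hz
            exact hz ▸ hi
          · simp only [φ₀, if_neg hi, hψq, mem_content_subst] at hz
            obtain ⟨_, -, hz⟩ := hz
            rw [content_letter, Finset.mem_singleton] at hz
            exact hz ▸ ht
        · intro hz
          exact ⟨z, hda hz, by simp [φ₀, hz]⟩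
      have hc₁ : (SWord.subst φ₁ a).content = a.content := by
        ext z
        rw [mem_content_subst]
        constructor
        · rintro ⟨i, hi', hz⟩
          by_cases hi : i ∈ d.content
          · simp only [φ₁, if_pos hi, content_letter, Finset.mem_singleton] at hz
            exact hz ▸ hi'
          · simp only [φ₁, if_neg hi, mem_content_subst] at hz
            obtain ⟨j, -, hz⟩ := hz
            simp only [ψ] at hz
            split_ifs at hz
            · exact hz
            · rw [content_letter, Finset.mem_singleton] at hz
              exact hda (hz ▸ ht)
        · intro hz
          refine ⟨y, hya, ?_⟩
          simp only [φ₁, if_neg hyd, mem_content_subst]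
          exact ⟨x, hxp, by simpa [ψ] using hz⟩
      have h₃ : T (SWord.subst φ₀ a) d := stepT (hI.subst _ ha) hd hb₀ hc₀
      have h₄ : T (SWord.subst φ₁ a) a := stepT (hI.subst _ ha) ha
        (b.trans (hgb hg') (b.trans hb₀ (b.symm had))) hc₁
      exact T.trans (T.symm h₄) (T.trans (gT hg') h₃)
    have key' : ∀ {a d : SWord}, a ∈ I → d ∈ I → b a d → T a d := by
      intro a d ha hd had
      by_cases hne : a.content ⊆ d.content
      · exact T.symm (key hd ha (b.symm had) hne)
      obtain ⟨y, hya, hyd⟩ := Finset.not_subset.1 hne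
      -- `φ` fixes `d` and gives the image of `a` all letters of both words, so `key` compares this
      -- image with each of them.
      let φ : ℕ → SWord := fun i => if i = y then a * d else letter i
      have hφ : SWord.subst φ d = d := by
        rw [subst_congr (ψ := letter), subst_id]
        intro i hi
        refine if_neg ?_
        rintro rfl
        exact hyd (mem_content.2 hi)
      have hb₀ : b (SWord.subst φ a) d := by
        have := hb φ had
        rwa [hφ] at this
      have hsub : (a * d).content ⊆ (SWord.subst φ a).content := by
        intro z hz
        rw [mem_content_subst]
        exact ⟨y, hya, by simpa [φ] using hz⟩
      rw [content_mul] at hsub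
      have h₃ := key (hI.subst φ ha) hd hb₀ (Finset.union_subset_right hsub)
      have h₄ := key (hI.subst φ ha) ha (b.trans hb₀ (b.symm had)) (Finset.union_subset_left hsub)
      exact T.trans (T.symm h₄) h₃
    have h₃ := hm g b hg hb hgb ⟨h₁', h₂⟩
    rw [Con.sup_rel_iff] at h₃
    clear h₁ h₁' h₂
    induction h₃ with
    | refl => exact T.refl _
    | tail _ h ih =>
      refine T.trans ih ?_
      rcases h with h | h
      · rcases hcon _ _ h.1 with h' | h'
        · exact (le_sup_left : c ⊓ contentCon ⊓ b ≤ T) ⟨⟨h.1, h'⟩, h.2⟩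
        · exact key' h'.1 h'.2 h.2
      · exact gT h

/-! ### Renamings, and modularity of nil-permutative congruences. -/

namespace SWord

/-- Renaming of letters. -/
abbrev rename (f : ℕ → ℕ) (w : SWord) : SWord := subst (fun i => letter (f i)) w

theorem letters_rename (f : ℕ → ℕ) (w : SWord) : (rename f w).letters = w.letters.map f := by
  rw [rename, letters_subst]
  simp only [letters_letter]
  induction w.letters <;> simp_all

theorem rename_rename (f g : ℕ → ℕ) (w : SWord) : rename f (rename g w) = rename (f ∘ g) w := by
  apply letters_injective
  simp [letters_rename]

theorem rename_congr {f g : ℕ → ℕ} {w : SWord} (h : ∀ i ∈ w.content, f i = g i) :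
    rename f w = rename g w :=
  subst_congr fun i hi => congrArg letter (h i (mem_content.2 hi))

theorem rename_id (w : SWord) : rename id w = w := subst_id w

theorem content_rename (f : ℕ → ℕ) (w : SWord) : (rename f w).content = w.content.image f := by
  ext x
  rw [mem_content_subst]
  simp [eq_comm]

theorem content_eq_of_perm {u v : SWord} (h : u.letters.Perm v.letters) : u.content = v.content := by
  ext x
  rw [mem_content, mem_content, h.mem_iff]

theorem length_letters_of_nodup {w : SWord} (h : w.letters.Nodup) :
    w.letters.length = w.content.card := (List.toFinset_card_of_nodup h).symm

theorem exists_perm_rename {a b : SWord} (ha : a.letters.Nodup) (hb : b.letters.Nodup)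
    (h : a.content = b.content) : ∃ τ : Equiv.Perm ℕ, b = rename τ a := by
  have hlen : a.letters.length = b.letters.length := by
    rw [length_letters_of_nodup ha, length_letters_of_nodup hb, h]
  let x : Fin a.letters.length ↪ ℕ := ⟨a.letters.get, List.nodup_iff_injective_get.1 ha⟩
  let y : Fin a.letters.length ↪ ℕ := ⟨fun i => b.letters.get (i.cast hlen), fun i j hij => by
    have := List.nodup_iff_injective_get.1 hb hij
    simpa [Fin.ext_iff] using this⟩
  have := Equiv.Perm.isMultiplyPretransitive ℕ a.letters.length
  obtain ⟨τ, hτ⟩ := MulAction.exists_smul_eq (Equiv.Perm ℕ) x y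
  refine ⟨τ, letters_injective ?_⟩
  rw [letters_rename]
  refine List.ext_get (by simp [hlen]) fun n h₁ h₂ => ?_
  have := DFunLike.congr_fun hτ ⟨n, hlen ▸ h₁⟩
  simpa [x, y] using this.symm

end SWord

/-- `c` is a fully invariant congruence with zero class `I` that outside of `I` only permutes
letters. -/
structure IsNilPermutative (c : Con SWord) (I : Set SWord) : Prop where
  fullyInvariant : FullyInvariant c
  ideal : IsFIIdeal I
  nonempty : I.Nonempty
  rel : ∀ a ∈ I, ∀ b ∈ I, c a b
  sat : ∀ {a b}, c a b → a ∈ I → b ∈ I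
  perm : ∀ {u v : SWord}, 4 ≤ u.letters.length → u.letters.Perm v.letters → c u v
  mem_of_not_nodup : ∀ {w : SWord}, 4 ≤ w.letters.length → ¬ w.letters.Nodup → w ∈ I
  short : ∃ f : SWord, f.letters.length = 3 ∧ f.content = {0, 1} ∧ ∀ w ∉ I, ¬ w.letters.Nodup →
    (∃ x, w = letter x * letter x) ∨ ∃ φ : ℕ → ℕ, φ 0 ≠ φ 1 ∧ w = rename φ f

/-- The words that are congruent to an element of `I`. -/
def Con.saturation (c : Con SWord) (I : Set SWord) : Set SWord := {w | ∃ i ∈ I, c w i}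

theorem Con.saturation_of_rel {c : Con SWord} {I : Set SWord} {a b : SWord} (h : c a b)
    (ha : a ∈ c.saturation I) : b ∈ c.saturation I := by
  obtain ⟨i, hi, hai⟩ := ha
  exact ⟨i, hi, c.trans (c.symm h) hai⟩

theorem Con.subset_saturation {c : Con SWord} {I : Set SWord} {a : SWord} (ha : a ∈ I) :
    a ∈ c.saturation I := ⟨a, ha, c.refl a⟩

/-- If a letter occurs on one side only, substituting an element of `I` for it moves that side into
`I` and fixes the other, which then lies in the saturation. -/
theorem FullyInvariant.content_eq {c : Con SWord} (hc : FullyInvariant c) {I : Set SWord}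
    (hI : IsFIIdeal I) (hne : I.Nonempty) {a b : SWord} (h : c a b)
    (ha : a ∉ c.saturation I) (hb : b ∉ c.saturation I) : a.content = b.content := by
  have key : ∀ {a b : SWord}, c a b → b ∉ c.saturation I → a.content ⊆ b.content := by
    intro a b h hb x hxa
    by_contra hxb
    obtain ⟨z, hz⟩ := hne
    let φ : ℕ → SWord := fun i => if i = x then z else letter i
    have hφ : subst φ b = b := by
      rw [subst_congr (ψ := letter), subst_id]
      intro i hi
      refine if_neg ?_
      rintro rfl
      exact hxb (mem_content.2 hi)
    refine hb ⟨subst φ a, hI.subst_mem_of_letter hxa (by simpa [φ] using hz), ?_⟩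
    have := hc φ (c.symm h)
    rwa [hφ] at this
  exact (key h hb).antisymm (key (c.symm h) ha)

namespace IsNilPermutative

variable {c : Con SWord} {I : Set SWord}

theorem content_eq_or (h : IsNilPermutative c I) {a b : SWord} (hab : c a b) :
    a.content = b.content ∨ a ∈ I ∧ b ∈ I := by
  by_cases ha : a ∈ I
  · exact Or.inr ⟨ha, h.sat hab ha⟩
  · refine Or.inl (h.fullyInvariant.content_eq h.ideal h.nonempty hab ?_ ?_)
    · rintro ⟨i, hi, hai⟩
      exact ha (h.sat (c.symm hai) hi)
    · rintro ⟨i, hi, hbi⟩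
      exact ha (h.sat (c.symm (c.trans hab hbi)) hi)

/-- Unless `b` is already in `I`, equality of content leaves `a` one letter (`b` a square) or two
distinct letters (`b` of length 3). A substitution then turns `a` into `b`, and it turns `b` into a
word of length at least 4 with a repeated letter, which lies in `I`. -/
theorem mem_saturation_of_nodup (h : IsNilPermutative c I) {g : Con SWord} (hg : FullyInvariant g)
    {a b : SWord} (hab : g a b) (hcon : a.content = b.content) (ha : a.letters.Nodup)
    (hb : ¬ b.letters.Nodup) : b ∈ g.saturation I := by
  by_contra hbI
  obtain ⟨f, hf, hf', hshort⟩ := h.short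
  rcases hshort b (fun hb' => hbI (Con.subset_saturation hb')) hb with ⟨x, rfl⟩ | ⟨φ, hφ, rfl⟩
  · have hla : a.letters.length = 1 := by rw [length_letters_of_nodup ha, hcon]; simp
    obtain ⟨y, hy⟩ := List.length_eq_one_iff.1 hla
    have hax : a = letter x := by
      apply letters_injective
      have : y ∈ (letter x * letter x).content := by rw [← hcon, mem_content, hy]; simp
      simp at this
      simp [hy, this]
    subst hax
    refine hbI ⟨(letter x * letter x) * (letter x * letter x), h.mem_of_not_nodup ?_ ?_, ?_⟩
    · simp [letters_mul]
    · simp [letters_mul]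
    · have := hg (fun _ => letter x * letter x) hab
      exact this
  · rw [content_rename, hf'] at hcon
    have hla : a.letters.length = 2 := by
      rw [length_letters_of_nodup ha, hcon, Finset.image_insert, Finset.image_singleton,
        Finset.card_pair hφ]
    obtain ⟨p, q, hpq⟩ := List.length_eq_two.1 hla
    obtain ⟨i, j, k, hijk⟩ := List.length_eq_three.1 hf
    have hpq' : p ≠ q := by rintro rfl; simp [hpq] at ha
    set b := rename φ f with hbdef
    have hbl : b.letters = [φ i, φ j, φ k] := by rw [hbdef, letters_rename, hijk]; rfl
    have haeq : a = letter p * letter q := letters_injective (by simp [hpq, letters_mul])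
    have hbc : b.content = a.content := by rw [hcon, hbdef, content_rename, hf']
    let ψ : ℕ → SWord := fun n => if n = p then letter (φ i) else letter (φ j) * letter (φ k)
    have hψa : subst ψ a = b := by
      apply letters_injective
      rw [haeq, map_mul, hbl]
      simp [ψ, hpq'.symm, letters_mul]
    have hq : q ∈ b.letters := by rw [← mem_content, hbc, mem_content, hpq]; simp
    have hlen : 4 ≤ (subst ψ b).letters.length := by
      rw [letters_subst, hbl]
      have h1 := fun n => (ψ n).letters_length_pos
      have h2 : (ψ q).letters.length = 2 := by simp [ψ, hpq'.symm, letters_mul]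
      have i1 := h1 (φ i)
      have i2 := h1 (φ j)
      have i3 := h1 (φ k)
      simp only [List.flatMap_cons, List.flatMap_nil, List.length_append, List.length_nil]
      rw [hbl] at hq
      simp only [List.mem_cons, List.not_mem_nil, or_false] at hq
      rcases hq with hq | hq | hq <;> rw [← hq, h2] <;> omega
    refine hbI ⟨subst ψ b, h.mem_of_not_nodup hlen ?_, ?_⟩
    · intro hnd
      have h3 := length_letters_of_nodup hnd
      have h4 : (subst ψ b).content ⊆ b.content := by
        intro z hz
        rw [mem_content_subst] at hz
        obtain ⟨n, -, hz⟩ := hz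
        rw [mem_content, hbl]
        simp only [ψ] at hz
        split_ifs at hz <;> simp at hz <;> simp [hz]
      have h5 := Finset.card_le_card h4
      rw [hbc, ← length_letters_of_nodup ha] at h5
      omega
    · have := hg ψ hab
      rwa [hψa] at this

/-- Words without repetitions and of equal content differ by a permutation of letters. Words with
repetitions outside `I` are squares or renamings of the single word `f`. The mixed case falls into
the saturation. -/
theorem exists_rename (h : IsNilPermutative c I) {g : Con SWord} (hg : FullyInvariant g)
    {a b : SWord} (hab : g a b) (ha : a ∉ g.saturation I) (hb : b ∉ g.saturation I) :
    a.content = b.content ∧ ∃ τ : Equiv.Perm ℕ, b = rename τ a := by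
  have hcon := hg.content_eq h.ideal h.nonempty hab ha hb
  refine ⟨hcon, ?_⟩
  by_cases ha' : a.letters.Nodup
  · by_cases hb' : b.letters.Nodup
    · exact exists_perm_rename ha' hb' hcon
    · exact absurd (h.mem_saturation_of_nodup hg hab hcon ha' hb') hb
  · by_cases hb' : b.letters.Nodup
    · exact absurd (h.mem_saturation_of_nodup hg (g.symm hab) hcon.symm hb' ha') ha
    · obtain ⟨f, hf, hf', hshort⟩ := h.short
      have hcard : ∀ {φ : ℕ → ℕ}, φ 0 ≠ φ 1 → (rename φ f).content = {φ 0, φ 1} := by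
        intro φ _
        rw [content_rename, hf', Finset.image_insert, Finset.image_singleton]
      rcases hshort a (fun hb' => ha (Con.subset_saturation hb')) ha' with ⟨x, rfl⟩ | ⟨φ, hφ, rfl⟩ <;>
      rcases hshort b (fun hb' => hb (Con.subset_saturation hb')) hb' with ⟨y, rfl⟩ | ⟨ψ, hψ, rfl⟩
      · refine ⟨1, ?_⟩
        have : x = y := by simpa using hcon
        subst this
        exact (rename_id _).symm
      · rw [hcard hψ] at hcon
        have := congrArg Finset.card hcon
        rw [Finset.card_pair hψ] at this
        simp at this
      · rw [hcard hφ] at hcon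
        have := congrArg Finset.card hcon
        rw [Finset.card_pair hφ] at this
        simp at this
      · rw [hcard hφ, hcard hψ] at hcon
        obtain ⟨τ, h0, h1⟩ : ∃ τ : Equiv.Perm ℕ, τ (φ 0) = ψ 0 ∧ τ (φ 1) = ψ 1 := by
          have e0 : φ 0 = ψ 0 ∨ φ 0 = ψ 1 := by
            have : φ 0 ∈ ({ψ 0, ψ 1} : Finset ℕ) := by rw [← hcon]; simp
            simpa using this
          have e1 : φ 1 = ψ 0 ∨ φ 1 = ψ 1 := by
            have : φ 1 ∈ ({ψ 0, ψ 1} : Finset ℕ) := by rw [← hcon]; simp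
            simpa using this
          rcases e0 with e0 | e0
          · exact ⟨1, e0, e1.resolve_left fun e => hφ (e0.trans e.symm)⟩
          · have e1 := e1.resolve_right fun e => hφ (e0.trans e.symm)
            refine ⟨Equiv.swap (φ 0) (φ 1), ?_, ?_⟩ <;> simp [e0, e1]
        refine ⟨τ, ?_⟩
        rw [rename_rename]
        refine rename_congr fun i hi => ?_
        rw [hf'] at hi
        simp only [Finset.mem_insert, Finset.mem_singleton] at hi
        rcases hi with rfl | rfl
        · exact h0.symm
        · exact h1.symm

end IsNilPermutative

theorem FullyInvariant.rename {c : Con SWord} (hc : FullyInvariant c) (f : ℕ → ℕ) {u v : SWord}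
    (h : c u v) : c (rename f u) (rename f v) := hc _ h

/-- The permutations of the content of `u` that act trivially modulo `c`. -/
def letterPerms {c : Con SWord} (hc : FullyInvariant c) (u : SWord) :
    Subgroup (Equiv.Perm u.content) where
  carrier := {τ | c u (rename (Equiv.Perm.ofSubtype τ) u)}
  one_mem' := by simpa using (rename_id u).symm ▸ c.refl u
  mul_mem' := by
    intro τ π hτ hπ
    have := c.trans hτ (hc.rename (Equiv.Perm.ofSubtype τ) hπ)
    rwa [rename_rename, ← Equiv.Perm.coe_mul, ← map_mul] at this
  inv_mem' := by
    intro τ hτ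
    have := hc.rename (Equiv.Perm.ofSubtype τ⁻¹) hτ
    rw [rename_rename, ← Equiv.Perm.coe_mul, ← map_mul] at this
    simp only [inv_mul_cancel, map_one, Equiv.Perm.coe_one, rename_id] at this
    exact c.symm this

theorem mem_letterPerms {c : Con SWord} {hc : FullyInvariant c} {u : SWord}
    {τ : Equiv.Perm u.content} :
    τ ∈ letterPerms hc u ↔ c u (rename (Equiv.Perm.ofSubtype τ) u) := Iff.rfl

theorem letterPerms_mono {c d : Con SWord} (hc : FullyInvariant c) (hd : FullyInvariant d)
    (h : c ≤ d) (u : SWord) : letterPerms hc u ≤ letterPerms hd u := fun _ hτ => h hτ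

/-- The modular law for subgroups of the symmetric groups of degree at most 3. -/
theorem Subgroup.modular_of_card_le {α : Type*} [Fintype α] (hα : Fintype.card α ≤ 3)
    (H A B : Subgroup (Equiv.Perm α)) (hAB : A ≤ B) : (H ⊔ A) ⊓ B ≤ (H ⊓ B) ⊔ A := by
  classical
  by_cases hA : A = ⊥
  · simp [hA]
  by_cases hB : B = ⊤
  · simp [hB]
  by_cases hne : A = B
  · subst hne; exact inf_le_right.trans le_sup_right
  -- `⊥ < A < B < ⊤` would require three successive proper divisibilities from 1 up to the order of
  -- the group, but that order divides 6, which has only two prime factors.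
  exfalso
  have hcard : Nat.card (Equiv.Perm α) = (Fintype.card α).factorial := by
    rw [Nat.card_eq_fintype_card, Fintype.card_perm]
  have h1 := Subgroup.card_dvd_of_le hAB
  have h2 := Subgroup.card_subgroup_dvd_card B
  have h3 : Nat.card A ≠ 1 := fun h => hA (Subgroup.card_eq_one.1 h)
  have h4 : Nat.card B ≠ Nat.card (Equiv.Perm α) := fun h => hB ((Subgroup.card_eq_iff_eq_top B).1 h)
  have h5 : Nat.card A ≠ Nat.card B := fun h =>
    hne (Subgroup.eq_of_le_of_card_ge hAB h.ge)
  rw [hcard] at h2 h4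
  have h6 : Nat.card B ≤ 6 := by
    refine (Nat.le_of_dvd (Nat.factorial_pos _) h2).trans ?_
    exact Nat.factorial_le hα
  generalize Nat.card A = x at *
  generalize Nat.card B = y at *
  generalize Fintype.card α = n at *
  have hx : x ≤ y := Nat.le_of_dvd (Nat.pos_of_dvd_of_pos h2 (Nat.factorial_pos _)) h1
  have hn : n.factorial = 1 ∨ n.factorial = 2 ∨ n.factorial = 6 := by
    interval_cases n <;> simp [Nat.factorial]
  generalize n.factorial = m at *
  rcases hn with rfl | rfl | rfl <;> interval_cases y <;> interval_cases x <;> omega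

namespace IsNilPermutative

variable {c : Con SWord} {I : Set SWord}

/-- The step applies some permutation `π` of the content after `τ`, and `π * τ = τ * (τ⁻¹ * π * τ)`.
Renaming the step by `τ⁻¹` shows that the last factor lies in the group of `u` itself, so one group
serves the whole chain. -/
theorem exists_mem_letterPerms (h : IsNilPermutative c I) {g : Con SWord} (hg : FullyInvariant g)
    {u : SWord} {τ : Equiv.Perm u.content} {w : SWord}
    (hab : g (rename (Equiv.Perm.ofSubtype τ) u) w)
    (ha : rename (Equiv.Perm.ofSubtype τ) u ∉ g.saturation I) (hb : w ∉ g.saturation I) :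
    ∃ σ ∈ letterPerms hg u, w = rename (Equiv.Perm.ofSubtype (τ * σ)) u := by
  obtain ⟨hcon, π, rfl⟩ := h.exists_rename hg hab ha hb
  set t := Equiv.Perm.ofSubtype τ with ht
  have hmem : ∀ x, t x ∈ u.content ↔ x ∈ u.content := fun x => by
    rw [ht]
    exact Equiv.Perm.ofSubtype_apply_mem_iff_mem τ x
  have himg : u.content.image t = u.content := by
    ext x
    rw [Finset.mem_image]
    constructor
    · rintro ⟨y, hy, rfl⟩
      exact (hmem y).2 hy
    · intro hx
      exact ⟨t⁻¹ x, by rw [← hmem]; simpa using hx, by simp⟩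
  have hcu : (rename t u).content = u.content := by rw [content_rename, himg]
  rw [hcu, content_rename, hcu] at hcon
  have hπ : ∀ x, π x ∈ u.content ↔ x ∈ u.content := by
    intro x
    constructor
    · intro hx
      rw [hcon, Finset.mem_image] at hx
      obtain ⟨y, hy, hyx⟩ := hx
      exact π.injective hyx ▸ hy
    · intro hx
      rw [hcon]
      exact Finset.mem_image_of_mem _ hx
  let π' : Equiv.Perm u.content := π.subtypePerm hπ
  have hπ' : ∀ x ∈ u.content, Equiv.Perm.ofSubtype π' x = π x := fun x hx => by
    rw [Equiv.Perm.ofSubtype_apply_of_mem π' hx]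
    rfl
  have hw : rename π (rename t u) = rename (Equiv.Perm.ofSubtype (π' * τ)) u := by
    rw [map_mul, Equiv.Perm.coe_mul, rename_rename]
    exact rename_congr fun x hx => (hπ' _ ((hmem x).2 hx)).symm
  refine ⟨τ⁻¹ * π' * τ, ?_, ?_⟩
  · rw [mem_letterPerms]
    have := hg.rename (Equiv.Perm.ofSubtype τ⁻¹) hab
    rw [hw, rename_rename, rename_rename, ht, ← Equiv.Perm.coe_mul, ← Equiv.Perm.coe_mul,
      ← map_mul, ← map_mul, inv_mul_cancel, map_one, Equiv.Perm.coe_one, rename_id,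
      ← mul_assoc] at this
    exact this
  · rw [hw]
    congr 3
    group

theorem isModularFIC (h : IsNilPermutative c I) : IsModularFIC c := by
  intro g b hg hb hgb u v ⟨h₁, h₂⟩
  replace h₁ : (c ⊔ g) u v := h₁
  replace h₂ : b u v := h₂
  rw [Con.sup_rel_iff] at h₁
  set T := c ⊓ b ⊔ g with hT
  have hcT : c ⊓ b ≤ T := le_sup_left
  have hgT : g ≤ T := le_sup_right
  -- The `g`-saturation of `I` is closed under `c` too: outside `I` a `c`-step is a renaming, and
  -- renamings preserve `I` and `g`.
  have hnear : ∀ {x y : SWord}, c x y ∨ g x y → x ∈ g.saturation I → y ∈ g.saturation I := by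
    rintro x y (hxy | hxy) hx
    · by_cases hxI : x ∈ I
      · exact Con.subset_saturation (h.sat hxy hxI)
      · have hnot : ∀ {z : SWord}, c x z → z ∉ c.saturation I := by
          rintro z hxz ⟨i, hi, hzi⟩
          exact hxI (h.sat (c.symm (c.trans hxz hzi)) hi)
        obtain ⟨-, τ, rfl⟩ := h.exists_rename h.fullyInvariant hxy (hnot (c.refl x)) (hnot hxy)
        obtain ⟨i, hi, hxi⟩ := hx
        exact ⟨rename τ i, h.ideal.subst _ hi, hg.rename τ hxi⟩
    · exact Con.saturation_of_rel hxy hx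
  by_cases hu : u ∈ g.saturation I
  · have hv : v ∈ g.saturation I := by
      clear h₂
      induction h₁ with
      | refl => exact hu
      | tail _ hs ih => exact hnear hs ih
    obtain ⟨i, hi, hui⟩ := hu
    obtain ⟨j, hj, hvj⟩ := hv
    refine T.trans (hgT hui) (T.trans (hcT ⟨h.rel i hi j hj, ?_⟩) (T.symm (hgT hvj)))
    exact b.trans (b.symm (hgb hui)) (b.trans h₂ (hgb hvj))
  · have hchain : v ∉ g.saturation I ∧
        ∃ τ ∈ letterPerms h.fullyInvariant u ⊔ letterPerms hg u,
          v = rename (Equiv.Perm.ofSubtype τ) u := by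
      clear h₂
      induction h₁ with
      | refl => exact ⟨hu, 1, one_mem _, by simpa using (rename_id u).symm⟩
      | @tail x y _ hs ih =>
        obtain ⟨hx, τ, hτ, rfl⟩ := ih
        have hy : y ∉ g.saturation I := fun hy => hx (hnear (hs.imp c.symm g.symm) hy)
        refine ⟨hy, ?_⟩
        rcases hs with hs | hs
        · have hnot : ∀ {z : SWord}, z ∉ g.saturation I → z ∉ c.saturation I := by
            rintro z hz ⟨i, hi, hzi⟩
            exact hz (Con.subset_saturation (h.sat (c.symm hzi) hi))
          obtain ⟨σ, hσ, rfl⟩ := h.exists_mem_letterPerms h.fullyInvariant hs (hnot hx) (hnot hy)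
          exact ⟨_, mul_mem hτ (Subgroup.mem_sup_left hσ), rfl⟩
        · obtain ⟨σ, hσ, rfl⟩ := h.exists_mem_letterPerms hg hs hx hy
          exact ⟨_, mul_mem hτ (Subgroup.mem_sup_right hσ), rfl⟩
    obtain ⟨-, τ, hτ, rfl⟩ := hchain
    by_cases hlen : 4 ≤ u.letters.length
    · have hlin : u.letters.Nodup := by
        by_contra hnd
        exact hu (Con.subset_saturation (h.mem_of_not_nodup hlen hnd))
      refine hcT ⟨h.perm hlen ?_, h₂⟩
      rw [letters_rename]
      refine (List.perm_ext_iff_of_nodup hlin (hlin.map (Equiv.injective _))).2 fun x => ?_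
      rw [List.mem_map]
      constructor
      · intro hx
        refine ⟨Equiv.Perm.ofSubtype τ⁻¹ x, ?_, ?_⟩
        · exact mem_content.1 ((Equiv.Perm.ofSubtype_apply_mem_iff_mem τ⁻¹ x).2 (mem_content.2 hx))
        · rw [← Equiv.Perm.mul_apply, ← map_mul, mul_inv_cancel, map_one, Equiv.Perm.one_apply]
      · rintro ⟨y, hy, rfl⟩
        exact mem_content.1 ((Equiv.Perm.ofSubtype_apply_mem_iff_mem τ y).2 (mem_content.2 hy))
    · have hcard : Fintype.card u.content ≤ 3 := by
        rw [Fintype.card_coe]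
        have := List.toFinset_card_le u.letters
        exact this.trans (by omega)
      have hmem := Subgroup.modular_of_card_le hcard _ _ _ (letterPerms_mono hg hb hgb u)
        ⟨hτ, (mem_letterPerms (hc := hb)).2 h₂⟩
      have hTfi : FullyInvariant T := (h.fullyInvariant.inf hb).sup hg
      have hle : letterPerms h.fullyInvariant u ⊓ letterPerms hb u ⊔ letterPerms hg u ≤
          letterPerms hTfi u :=
        sup_le (fun σ hσ => hcT ⟨hσ.1, hσ.2⟩) (letterPerms_mono hg hTfi hgT u)
      exact hle hmem

end IsNilPermutative

/-! ### Permutational identities of length 4 and the four systems. -/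

namespace SWord

theorem exists_perm_of_not_nodup {l : List ℕ} (h : ¬ l.Nodup) :
    ∃ (x : ℕ) (l' : List ℕ), l.Perm (x :: x :: l') := by
  obtain ⟨x, hx⟩ := List.exists_duplicate_iff_not_nodup.2 h
  obtain ⟨l', hl'⟩ := (List.duplicate_iff_sublist.1 hx).exists_perm_append
  exact ⟨x, l', hl'⟩

/-- The assignment of four words to the letters `0`, `1`, `2`, `3`. -/
def vals (x y z t : SWord) : ℕ → SWord
  | 0 => x
  | 1 => y
  | 2 => z
  | _ => t

end SWord

/-- All permutational identities of length 4 hold modulo `c`. -/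
structure HasSwaps (c : Con SWord) : Prop where
  swap₁₂ : ∀ x y z t : SWord, c (x * (y * (z * t))) (y * (x * (z * t)))
  swap₂₃ : ∀ x y z t : SWord, c (x * (y * (z * t))) (x * (z * (y * t)))
  swap₃₄ : ∀ x y z t : SWord, c (x * (y * (z * t))) (x * (y * (t * z)))

namespace HasSwaps

variable {c : Con SWord}

/-- Two further letters are exactly what allows the word to be cut into four nonempty factors, two
of them being `a` and `b`. -/
theorem rel_swap (h : HasSwaps c) {p q : List ℕ} (a b : ℕ) (hlen : 2 ≤ p.length + q.length)
    {u v : SWord} (hu : u.letters = p ++ a :: b :: q) (hv : v.letters = p ++ b :: a :: q) :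
    c u v := by
  have key : ∀ x y z t x' y' z' t' : SWord,
      p ++ a :: b :: q = (x * (y * (z * t))).letters →
      p ++ b :: a :: q = (x' * (y' * (z' * t'))).letters →
      c (x * (y * (z * t))) (x' * (y' * (z' * t'))) → c u v := by
    intro x y z t x' y' z' t' e₁ e₂ hc
    rwa [letters_injective (hu.trans e₁), letters_injective (hv.trans e₂)]
  rcases p with _ | ⟨p₀, p⟩
  · rcases q with _ | ⟨q₀, q⟩
    · simp at hlen
    · obtain ⟨t, ht⟩ := exists_letters (l := q) (by rintro rfl; simp at hlen)
      exact key _ _ _ _ _ _ _ _ (by simp [letters_mul, ht]) (by simp [letters_mul, ht])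
        (h.swap₁₂ (letter a) (letter b) (letter q₀) t)
  · rcases q with _ | ⟨q₀, q⟩
    · obtain ⟨y, hy⟩ := exists_letters (l := p) (by rintro rfl; simp at hlen)
      exact key _ _ _ _ _ _ _ _ (by simp [letters_mul, hy]) (by simp [letters_mul, hy])
        (h.swap₃₄ (letter p₀) y (letter a) (letter b))
    · obtain ⟨x, hx⟩ := exists_letters (l := p₀ :: p) (by simp)
      obtain ⟨t, ht⟩ := exists_letters (l := q₀ :: q) (by simp)
      exact key _ _ _ _ _ _ _ _ (by simp [letters_mul, hx, ht]) (by simp [letters_mul, hx, ht])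
        (h.swap₂₃ x (letter a) (letter b) t)

theorem rel_of_perm (h : HasSwaps c) {u v : SWord} (hlen : 4 ≤ u.letters.length)
    (huv : u.letters.Perm v.letters) : c u v := by
  have key : ∀ {l l' : List ℕ}, l.Perm l' → ∀ p : List ℕ, 4 ≤ p.length + l.length →
      ∀ u v : SWord, u.letters = p ++ l → v.letters = p ++ l' → c u v := by
    intro l l' hl
    induction hl with
    | nil =>
      intro p _ u v hu hv
      rw [letters_injective (hu.trans hv.symm)]
      exact c.refl v
    | cons x _ ih =>
      intro p hp u v hu hv
      exact ih (p ++ [x]) (by simpa [add_assoc, add_comm 1] using hp) u v (by simp [hu]) (by simp [hv])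
    | swap x y l =>
      intro p hp u v hu hv
      exact h.rel_swap y x (by simp at hp; omega) hu hv
    | @trans l₁ l₂ l₃ h₁ h₂ ih₁ ih₂ =>
      intro p hp u v hu hv
      obtain ⟨w, hw⟩ := exists_letters (l := p ++ l₂) (by
        intro he
        have := congrArg List.length he
        rw [List.length_append, ← h₁.length_eq, List.length_nil] at this
        omega)
      exact c.trans (ih₁ p hp u w hu hw) (ih₂ p (by rwa [← h₁.length_eq]) w v hw hv)
  exact key huv [] (by simpa using hlen) u v rfl rfl

end HasSwaps

/-- Common criterion for the four systems. By `hw`, a long word with a repeated letter can be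
rearranged to begin with an instance of `w`, so it is zero. The word `f` represents the only
two-letter pattern of length 3 that may be nonzero. -/
theorem IsNilPermutative.of_zero {c : Con SWord} (hfi : FullyInvariant c) (hs : HasSwaps c)
    {w : SWord} (hl : ∀ φ b, c (b * subst φ w) (subst φ w))
    (hr : ∀ φ b, c (subst φ w * b) (subst φ w))
    (hw : ∀ x y : ℕ, ∃ φ : ℕ → SWord, (subst φ w).letters.Perm [x, x, y])
    (f : SWord) (hf : f.letters.length = 3) (hf' : f.content = {0, 1})
    (hpat : ∀ a b, a ≠ b → ∀ v : SWord,
      v.letters = [a, a, b] ∨ v.letters = [a, b, a] ∨ v.letters = [b, a, a] →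
        (∃ ψ, c v (subst ψ w)) ∨ ∃ φ : ℕ → ℕ, φ 0 ≠ φ 1 ∧ v = rename φ f) :
    IsNilPermutative c {a | c a w} := by
  have hsub : ∀ φ, c (subst φ w) w := by
    intro φ
    have h₁ := hr φ w
    have h₂ := hl letter (subst φ w)
    rw [subst_id] at h₂
    exact c.trans (c.symm h₁) h₂
  have hl' : ∀ b, c (b * w) w := fun b => by simpa only [subst_id] using hl letter b
  have hr' : ∀ b, c (w * b) w := fun b => by simpa only [subst_id] using hr letter b
  have hmem : ∀ {v : SWord}, 4 ≤ v.letters.length → ¬ v.letters.Nodup → c v w := by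
    intro v hv hnd
    obtain ⟨x, l, hxl⟩ := exists_perm_of_not_nodup hnd
    rcases l with _ | ⟨y, l⟩
    · rw [hxl.length_eq] at hv; simp at hv
    obtain ⟨b, hb⟩ := exists_letters (l := l) (by
      rintro rfl
      rw [hxl.length_eq] at hv; simp at hv)
    obtain ⟨φ, hφ⟩ := hw x y
    refine c.trans (hs.rel_of_perm (v := subst φ w * b) hv ?_) (c.trans (hr φ b) (hsub φ))
    rw [letters_mul, hb]
    exact hxl.trans (hφ.symm.append_right l)
  refine ⟨hfi, ⟨?_, ?_, ?_⟩, ⟨w, c.refl w⟩, ?_, ?_, ?_, ?_, f, hf, hf', ?_⟩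
  · exact fun b ha => c.trans (c.mul (c.refl b) ha) (hl' b)
  · exact fun b ha => c.trans (c.mul ha (c.refl b)) (hr' b)
  · exact fun φ ha => c.trans (hfi φ ha) (hsub φ)
  · exact fun a ha b hb => c.trans ha (c.symm hb)
  · exact fun hab ha => c.trans (c.symm hab) ha
  · exact fun hu huv => hs.rel_of_perm hu huv
  · exact hmem
  · intro v hv hnd
    have hlen : v.letters.length < 4 := by
      by_contra h
      exact hv (hmem (by omega) hnd)
    have hv' : v.letters.length = 0 ∨ v.letters.length = 1 ∨ v.letters.length = 2 ∨
      v.letters.length = 3 := by omega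
    rcases hv' with h | h | h | h
    · exact absurd (List.length_eq_zero_iff.1 h) v.letters_ne_nil
    · obtain ⟨x, hx⟩ := List.length_eq_one_iff.1 h
      simp [hx] at hnd
    · obtain ⟨x, y, hx⟩ := List.length_eq_two.1 h
      have : x = y := by simpa [hx] using hnd
      exact Or.inl ⟨x, letters_injective (by simp [hx, this, letters_mul])⟩
    · obtain ⟨x, y, z, hx⟩ := List.length_eq_three.1 h
      refine Or.inr ?_
      by_cases hcube : x = y ∧ x = z
      · obtain ⟨rfl, rfl⟩ := hcube
        exfalso
        obtain ⟨φ, hφ⟩ := hw x x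
        have := List.perm_replicate.1 (show (subst φ w).letters.Perm (List.replicate 3 x) from hφ)
        have hv' : v = subst φ w := letters_injective (by rw [hx, this]; rfl)
        exact hv (hv' ▸ hsub φ)
      · have : ∃ a b, a ≠ b ∧ (v.letters = [a, a, b] ∨ v.letters = [a, b, a] ∨
            v.letters = [b, a, a]) := by
          by_cases hxy : x = y
          · subst hxy
            exact ⟨x, z, fun e => hcube ⟨rfl, e⟩, Or.inl hx⟩
          · by_cases hxz : x = z
            · subst hxz
              exact ⟨x, y, hxy, Or.inr (Or.inl hx)⟩
            · have hyz : y = z := by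
                by_contra hyz
                exact hnd (by simp [hx, hxy, hxz, hyz])
              subst hyz
              exact ⟨y, x, fun e => hxy e.symm, Or.inr (Or.inr hx)⟩
        obtain ⟨a, b, hab, h⟩ := this
        exact (hpat a b hab v h).resolve_left fun ⟨ψ, hψ⟩ => hv (c.trans hψ (hsub ψ))

/-- Among four factors, the identity gives the transpositions (1 3), (2 4) and, with the middle two
taken as one, (1 4). They form a tree on the positions, so they generate all permutations. -/
theorem HasSwaps.of_reverse {c : Con SWord} (h : ∀ x y z : SWord, c (x * (y * z)) (z * (y * x))) :
    HasSwaps c := by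
  have h13 : ∀ x y z t : SWord, c (x * (y * (z * t))) (z * (y * (x * t))) := fun x y z t => by
    simpa only [mul_assoc] using c.mul (h x y z) (c.refl t)
  have h24 : ∀ x y z t : SWord, c (x * (y * (z * t))) (x * (t * (z * y))) := fun x y z t =>
    c.mul (c.refl x) (h y z t)
  have h14 : ∀ x y z t : SWord, c (x * (y * (z * t))) (t * (y * (z * x))) := fun x y z t => by
    simpa only [mul_assoc] using h x (y * z) t
  have h12 : ∀ x y z t : SWord, c (x * (y * (z * t))) (y * (x * (z * t))) := fun x y z t =>
    c.trans (h14 x y z t) (c.trans (h24 _ _ _ _) (h14 _ _ _ _))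
  exact ⟨h12, fun x y z t => c.trans (h13 x y z t) (c.trans (h12 _ _ _ _) (h13 _ _ _ _)),
    fun x y z t => c.trans (h13 x y z t) (c.trans (h14 _ _ _ _) (h13 _ _ _ _))⟩

/-- The 3-cycles on the first and on the last three positions generate the even permutations; taking
the last two factors as one yields a 4-cycle, which is odd. -/
theorem HasSwaps.of_rotate {c : Con SWord} (h : ∀ x y z : SWord, c (x * (y * z)) (y * (z * x))) :
    HasSwaps c := by
  have hf : ∀ x y z t : SWord, c (x * (y * (z * t))) (y * (z * (x * t))) := fun x y z t => by
    simpa only [mul_assoc] using c.mul (h x y z) (c.refl t)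
  have hb : ∀ x y z t : SWord, c (x * (y * (z * t))) (x * (z * (t * y))) := fun x y z t =>
    c.mul (c.refl x) (h y z t)
  have hr : ∀ x y z t : SWord, c (x * (y * (z * t))) (y * (z * (t * x))) := fun x y z t => by
    simpa only [mul_assoc] using h x y (z * t)
  have h12 : ∀ x y z t : SWord, c (x * (y * (z * t))) (y * (x * (z * t))) := fun x y z t =>
    c.trans (hr x y z t) (c.trans (hb _ _ _ _) (hb _ _ _ _))
  have h23 : ∀ x y z t : SWord, c (x * (y * (z * t))) (x * (z * (y * t))) := fun x y z t =>
    c.trans (hf x y z t) (c.trans (h12 _ _ _ _) (c.trans (hf _ _ _ _) (hf _ _ _ _)))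
  exact ⟨h12, h23, fun x y z t =>
    c.trans (hb x y z t) (c.trans (h23 _ _ _ _) (c.trans (hb _ _ _ _) (hb _ _ _ _)))⟩

theorem HasSwaps.of_swap_left {c : Con SWord} (h : ∀ x y z : SWord, c (x * (y * z)) (y * (x * z)))
    (h34 : ∀ x y z t : SWord, c (x * (y * (z * t))) (x * (y * (t * z)))) : HasSwaps c := by
  refine ⟨fun x y z t => h x y (z * t), fun x y z t => c.mul (c.refl x) (h y z t), h34⟩

theorem HasSwaps.of_swap_right {c : Con SWord} (h : ∀ x y z : SWord, c (x * (y * z)) (x * (z * y)))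
    (h12 : ∀ x y z t : SWord, c (x * (y * (z * t))) (y * (x * (z * t)))) : HasSwaps c := by
  have h34 : ∀ x y z t : SWord, c (x * (y * (z * t))) (x * (y * (t * z))) := fun x y z t =>
    c.mul (c.refl x) (h y z t)
  refine ⟨h12, fun x y z t => c.trans (y := x * (z * (t * y))) ?_ (h34 x z t y), h34⟩
  simpa only [mul_assoc] using h x y (z * t)

namespace SemigroupVariety

variable {N : SemigroupVariety.{u}}

theorem zero_left_of_satisfiesAll {w : SWord} {E : Set SIdentity} (hE : zeroIdentities w ⊆ E)
    (h : N.SatisfiesAll E) {i : ℕ} (hi : i ∉ w.letters) (φ : ℕ → SWord) (b : SWord) :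
    N.eqTheory (b * subst φ w) (subst φ w) := by
  have h₁ : N.eqTheory (letter i * w) w := h _ (hE ⟨i, hi, Or.inl rfl⟩)
  have h₂ := N.fullyInvariant_eqTheory (fun j => if j = i then b else φ j) h₁
  have h₃ : subst (fun j => if j = i then b else φ j) w = subst φ w := by
    refine subst_congr fun j hj => if_neg ?_
    rintro rfl
    exact hi hj
  rw [map_mul, h₃] at h₂
  simpa using h₂

theorem zero_right_of_satisfiesAll {w : SWord} {E : Set SIdentity} (hE : zeroIdentities w ⊆ E)
    (h : N.SatisfiesAll E) {i : ℕ} (hi : i ∉ w.letters) (φ : ℕ → SWord) (b : SWord) :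
    N.eqTheory (subst φ w * b) (subst φ w) := by
  have h₁ : N.eqTheory (w * letter i) w := h _ (hE ⟨i, hi, Or.inr rfl⟩)
  have h₂ := N.fullyInvariant_eqTheory (fun j => if j = i then b else φ j) h₁
  have h₃ : subst (fun j => if j = i then b else φ j) w = subst φ w := by
    refine subst_congr fun j hj => if_neg ?_
    rintro rfl
    exact hi hj
  rw [map_mul, h₃] at h₂
  simpa using h₂

theorem rel_of_mem {E : Set SIdentity} (h : N.SatisfiesAll E) {u v : SWord} (hE : (u ≈≈ v) ∈ E)
    (φ : ℕ → SWord) : N.eqTheory (subst φ u) (subst φ v) :=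
  N.fullyInvariant_eqTheory φ (h _ hE)

theorem isNilPermutative_of_system₁ (h : N.SatisfiesAll identitySystem1) :
    IsNilPermutative N.eqTheory {a | N.eqTheory a (letter 0 * letter 0 * letter 1)} := by
  have h₁ : ∀ x y z : SWord, N.eqTheory (x * (y * z)) (z * (y * x)) := fun x y z => by
    simpa [vals, mul_assoc] using rel_of_mem h (Or.inl rfl) (vals x y z x)
  refine .of_zero N.fullyInvariant_eqTheory (.of_reverse h₁)
    (zero_left_of_satisfiesAll (fun _ => Or.inr) h (i := 2) (by simp [letters_mul]))
    (zero_right_of_satisfiesAll (fun _ => Or.inr) h (i := 2) (by simp [letters_mul]))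
    (fun x y => ⟨vals (letter x) (letter y) (letter x) (letter x), .refl _⟩)
    (letter 0 * letter 1 * letter 0) rfl (by decide) fun a b hab v hv => ?_
  rcases hv with hv | hv | hv
  · obtain rfl : v = letter a * (letter a * letter b) := letters_injective hv
    exact Or.inl ⟨vals (letter a) (letter b) (letter a) (letter a), N.eqTheory.refl _⟩
  · obtain rfl : v = letter a * letter b * letter a := letters_injective hv
    exact Or.inr ⟨fun n => if n = 0 then a else b, by simpa using hab, by simp⟩
  · obtain rfl : v = letter b * (letter a * letter a) := letters_injective hv
    exact Or.inl ⟨vals (letter a) (letter b) (letter a) (letter a), h₁ _ _ _⟩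

theorem isNilPermutative_of_system₂ (h : N.SatisfiesAll identitySystem2) :
    IsNilPermutative N.eqTheory {a | N.eqTheory a (letter 0 * letter 0 * letter 1)} := by
  have h₁ : ∀ x y z : SWord, N.eqTheory (x * (y * z)) (y * (z * x)) := fun x y z => by
    simpa [vals, mul_assoc] using rel_of_mem h (Or.inl rfl) (vals x y z x)
  refine .of_zero N.fullyInvariant_eqTheory (.of_rotate h₁)
    (zero_left_of_satisfiesAll (fun _ => Or.inr) h (i := 2) (by simp [letters_mul]))
    (zero_right_of_satisfiesAll (fun _ => Or.inr) h (i := 2) (by simp [letters_mul]))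
    (fun x y => ⟨vals (letter x) (letter y) (letter x) (letter x), .refl _⟩)
    -- Here all three patterns are zero, so the choice of `f` is immaterial.
    (letter 0 * letter 1 * letter 0) rfl (by decide) fun a b hab v hv => Or.inl
      ⟨vals (letter a) (letter b) (letter a) (letter a), ?_⟩
  rcases hv with hv | hv | hv
  · obtain rfl : v = letter a * (letter a * letter b) := letters_injective hv
    exact N.eqTheory.refl _
  · obtain rfl : v = letter a * (letter b * letter a) := letters_injective hv
    exact N.eqTheory.symm (h₁ (letter a) (letter a) (letter b))
  · obtain rfl : v = letter b * (letter a * letter a) := letters_injective hv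
    exact h₁ _ _ _

theorem isNilPermutative_of_system₃ (h : N.SatisfiesAll identitySystem3) :
    IsNilPermutative N.eqTheory {a | N.eqTheory a (letter 0 * letter 1 * letter 1)} := by
  have h₁ : ∀ x y z : SWord, N.eqTheory (x * (y * z)) (y * (x * z)) := fun x y z => by
    simpa [vals, mul_assoc] using rel_of_mem h (Or.inl (Or.inl rfl)) (vals x y z x)
  have h₂ : ∀ x y z t : SWord, N.eqTheory (x * (y * (z * t))) (x * (z * (t * y))) :=
    fun x y z t => by
      simpa [vals, mul_assoc] using rel_of_mem h (Or.inl (Or.inr rfl)) (vals x y z t)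
  refine .of_zero N.fullyInvariant_eqTheory (.of_swap_left h₁ fun x y z t =>
      N.eqTheory.trans (h₂ x y z t) (N.eqTheory.trans
        (N.eqTheory.mul (N.eqTheory.refl x) (h₁ z t y)) (N.eqTheory.symm (h₂ x y t z))))
    (zero_left_of_satisfiesAll (fun _ => Or.inr) h (i := 2) (by simp [letters_mul]))
    (zero_right_of_satisfiesAll (fun _ => Or.inr) h (i := 2) (by simp [letters_mul]))
    (fun x y => ⟨vals (letter y) (letter x) (letter x) (letter x), ?_⟩)
    (letter 0 * letter 0 * letter 1) rfl (by decide) fun a b hab v hv => ?_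
  · exact (List.perm_append_comm : ([y] ++ [x, x]).Perm ([x, x] ++ [y]))
  rcases hv with hv | hv | hv
  · obtain rfl : v = letter a * letter a * letter b := letters_injective hv
    exact Or.inr ⟨fun n => if n = 0 then a else b, by simpa using hab, by simp⟩
  · obtain rfl : v = letter a * (letter b * letter a) := letters_injective hv
    exact Or.inl ⟨vals (letter b) (letter a) (letter a) (letter a), h₁ _ _ _⟩
  · obtain rfl : v = letter b * (letter a * letter a) := letters_injective hv
    exact Or.inl ⟨vals (letter b) (letter a) (letter a) (letter a), N.eqTheory.refl _⟩

theorem isNilPermutative_of_system₄ (h : N.SatisfiesAll identitySystem4) :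
    IsNilPermutative N.eqTheory {a | N.eqTheory a (letter 0 * letter 0 * letter 1)} := by
  have h₁ : ∀ x y z : SWord, N.eqTheory (x * (y * z)) (x * (z * y)) := fun x y z => by
    simpa [vals, mul_assoc] using rel_of_mem h (Or.inl (Or.inl rfl)) (vals x y z x)
  have h₂ : ∀ x y z t : SWord, N.eqTheory (x * (y * (z * t))) (y * (z * (x * t))) :=
    fun x y z t => by
      simpa [vals, mul_assoc] using rel_of_mem h (Or.inl (Or.inr rfl)) (vals x y z t)
  have h₂₃ : ∀ x y z t : SWord, N.eqTheory (x * (y * (z * t))) (x * (z * (y * t))) :=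
    fun x y z t => by
      refine N.eqTheory.trans (y := x * (z * (t * y))) ?_
        (N.eqTheory.mul (N.eqTheory.refl x) (h₁ z t y))
      simpa only [mul_assoc] using h₁ x y (z * t)
  refine .of_zero N.fullyInvariant_eqTheory (.of_swap_right h₁ fun x y z t =>
      N.eqTheory.trans (h₂ x y z t) (h₂₃ _ _ _ _))
    (zero_left_of_satisfiesAll (fun _ => Or.inr) h (i := 2) (by simp [letters_mul]))
    (zero_right_of_satisfiesAll (fun _ => Or.inr) h (i := 2) (by simp [letters_mul]))
    (fun x y => ⟨vals (letter x) (letter y) (letter x) (letter x), .refl _⟩)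
    (letter 1 * letter 0 * letter 0) rfl (by decide) fun a b hab v hv => ?_
  rcases hv with hv | hv | hv
  · obtain rfl : v = letter a * (letter a * letter b) := letters_injective hv
    exact Or.inl ⟨vals (letter a) (letter b) (letter a) (letter a), N.eqTheory.refl _⟩
  · obtain rfl : v = letter a * (letter b * letter a) := letters_injective hv
    exact Or.inl ⟨vals (letter a) (letter b) (letter a) (letter a), h₁ _ _ _⟩
  · obtain rfl : v = letter b * letter a * letter a := letters_injective hv
    exact Or.inr ⟨fun n => if n = 0 then a else b, by simpa using hab, by simp⟩

theorem isModularElement_of_satisfiesAll {V M : SemigroupVariety.{u}}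
    (hM : M = trivialVariety ∨ M = semilatticeVariety)
    (hN : N.SatisfiesAll identitySystem1 ∨ N.SatisfiesAll identitySystem2 ∨
      N.SatisfiesAll identitySystem3 ∨ N.SatisfiesAll identitySystem4)
    (hV : V = M ⊔ N) : IsModularElement V := by
  obtain ⟨I, hI⟩ : ∃ I, IsNilPermutative N.eqTheory I := by
    rcases hN with h | h | h | h
    · exact ⟨_, isNilPermutative_of_system₁ h⟩
    · exact ⟨_, isNilPermutative_of_system₂ h⟩
    · exact ⟨_, isNilPermutative_of_system₃ h⟩
    · exact ⟨_, isNilPermutative_of_system₄ h⟩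
  rw [isModularElement_iff, hV, eqTheory_sup]
  rcases hM with rfl | rfl
  · have htop : trivialVariety.{u}.eqTheory = ⊤ := by
      refine top_le_iff.1 fun a b _ S _ hS φ => ?_
      simpa using hS _ rfl fun i => if i = 0 then FreeSemigroup.lift φ a else FreeSemigroup.lift φ b
    rw [htop, top_inf_eq]
    exact hI.isModularFIC
  · rw [eqTheory_semilatticeVariety, inf_comm]
    exact hI.isModularFIC.inf_contentCon hI.ideal hI.rel fun a b => hI.content_eq_or

end SemigroupVariety

/-! ### The exchange principle and the test congruences. -/

/-- Modularity replaces the given chain by one made of `c ⊓ b`-steps and `g`-steps. It has to leave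
`C`, and `g`-steps cannot do so. -/
theorem IsModularFIC.exists_rel {c g b : Con SWord} (hm : IsModularFIC c) (hg : FullyInvariant g)
    (hb : FullyInvariant b) (hgb : g ≤ b) {C : Set SWord} (hC : ∀ a d, g a d → a ∈ C → d ∈ C)
    {u v : SWord} (hu : u ∈ C) (hv : v ∉ C) (h : (c ⊔ g) u v) (hbuv : b u v) :
    ∃ a ∈ C, ∃ d ∉ C, c a d ∧ b a d := by
  by_contra! H
  have h' := hm g b hg hb hgb ⟨h, hbuv⟩
  rw [Con.sup_rel_iff] at h'
  refine hv ?_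
  clear hv h hbuv
  induction h' with
  | refl => exact hu
  | @tail x y _ hs ih =>
    rcases hs with hs | hs
    · by_contra hy
      exact H x ih y hy hs.1 hs.2
    · exact hC x y hs ih

/-- The restriction of a congruence to an ideal, extended by the equality relation. -/
def reesCon {J : Set SWord} (hJ : IsFIIdeal J) (k : Con SWord) : Con SWord where
  r u v := u = v ∨ u ∈ J ∧ v ∈ J ∧ k u v
  iseqv := by
    refine ⟨fun _ => Or.inl rfl, ?_, ?_⟩
    · rintro u v (rfl | ⟨hu, hv, h⟩)
      · exact Or.inl rfl
      · exact Or.inr ⟨hv, hu, k.symm h⟩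
    · rintro u v w (rfl | ⟨hu, hv, h⟩) (rfl | ⟨hv', hw, h'⟩)
      · exact Or.inl rfl
      · exact Or.inr ⟨hv', hw, h'⟩
      · exact Or.inr ⟨hu, hv, h⟩
      · exact Or.inr ⟨hu, hw, k.trans h h'⟩
  mul' := by
    rintro w x y z (rfl | ⟨hw, hx, h⟩) (rfl | ⟨hy, hz, h'⟩)
    · exact Or.inl rfl
    · exact Or.inr ⟨hJ.mul_left _ hy, hJ.mul_left _ hz, k.mul (k.refl _) h'⟩
    · exact Or.inr ⟨hJ.mul_right _ hw, hJ.mul_right _ hx, k.mul h (k.refl _)⟩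
    · exact Or.inr ⟨hJ.mul_right _ hw, hJ.mul_right _ hx, k.mul h h'⟩

theorem FullyInvariant.reesCon {J : Set SWord} (hJ : IsFIIdeal J) {k : Con SWord}
    (hk : FullyInvariant k) : FullyInvariant (reesCon hJ k) := by
  rintro φ u v (rfl | ⟨hu, hv, h⟩)
  · exact Or.inl rfl
  · exact Or.inr ⟨hJ.subst φ hu, hJ.subst φ hv, hk φ h⟩

theorem reesCon_le {J : Set SWord} (hJ : IsFIIdeal J) (k : Con SWord) : reesCon hJ k ≤ k := by
  rintro u v (rfl | ⟨-, -, h⟩)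
  · exact k.refl _
  · exact h

namespace SWord

theorem length_subst_eq (φ : ℕ → SWord) {w : SWord}
    (h : (subst φ w).letters.length ≤ w.letters.length) {i : ℕ} (hi : i ∈ w.content) :
    (φ i).letters.length = 1 := by
  induction w using inductionOn with
  | letter j =>
    obtain rfl : i = j := by simpa using hi
    have := (φ i).letters_length_pos
    simp at h
    omega
  | mul j v ih =>
    have h₁ := (φ j).letters_length_pos
    have h₂ := length_le_subst φ v
    simp only [map_mul, letters_mul, List.length_append, letters_letter, List.length_singleton,
      subst_letter] at h
    rw [content_mul, Finset.mem_union] at hi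
    rcases hi with hi | hi
    · obtain rfl : i = j := by simpa using hi
      omega
    · exact ih (by omega) hi

theorem subst_eq_rename_head {φ : ℕ → SWord} {w : SWord}
    (h : ∀ i ∈ w.content, (φ i).letters.length = 1) :
    subst φ w = rename (fun i => (φ i).head) w := by
  refine subst_congr fun i hi => letters_injective ?_
  obtain ⟨x, hx⟩ := List.length_eq_one_iff.1 (h i (mem_content.2 hi))
  obtain ⟨h₁, -⟩ : (φ i).head = x ∧ (φ i).tail = [] := by simpa [letters] using hx
  rw [hx, letters_letter]
  exact congrArg ([·]) h₁.symm

theorem exists_subst_eq_rename (φ : ℕ → SWord) {w : SWord}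
    (h : (subst φ w).letters.length ≤ w.letters.length) : ∃ f : ℕ → ℕ, subst φ w = rename f w :=
  ⟨_, subst_eq_rename_head fun _ => length_subst_eq φ h⟩

theorem not_nodup_subst (φ : ℕ → SWord) {w : SWord} (h : ¬ w.letters.Nodup) :
    ¬ (subst φ w).letters.Nodup := by
  obtain ⟨x, l, hl⟩ := exists_perm_of_not_nodup h
  intro hnd
  rw [letters_subst, (hl.flatMap_right _).nodup_iff] at hnd
  have hx := (φ x).head_mem_content
  rw [mem_content] at hx
  rw [List.flatMap_cons, List.flatMap_cons, List.nodup_append] at hnd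
  exact hnd.2.2 _ hx _ (List.mem_append_left _ hx) rfl

theorem card_content_le (w : SWord) : w.content.card ≤ w.letters.length :=
  List.toFinset_card_le _

/-- Words longer than `n` together with all substitution instances of words from `S`. -/
def longOrInstance (n : ℕ) (S : Set SWord) : Set SWord :=
  {w | n < w.letters.length ∨ ∃ s ∈ S, ∃ φ, w = subst φ s}

theorem isFIIdeal_longOrInstance {n : ℕ} {S : Set SWord} (hS : ∀ s ∈ S, s.letters.length = n) :
    IsFIIdeal (longOrInstance n S) := by
  have hlen : ∀ {w}, w ∈ longOrInstance n S → n ≤ w.letters.length := by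
    rintro w (h | ⟨s, hs, φ, rfl⟩)
    · exact h.le
    · rw [← hS s hs]
      exact length_le_subst φ s
  refine ⟨fun {a} b ha => Or.inl ?_, fun {a} b ha => Or.inl ?_, ?_⟩
  · have := hlen ha
    have := b.letters_length_pos
    rw [letters_mul, List.length_append]
    omega
  · have := hlen ha
    have := b.letters_length_pos
    rw [letters_mul, List.length_append]
    omega
  · rintro w φ (h | ⟨s, hs, ψ, rfl⟩)
    · exact Or.inl (h.trans_le (length_le_subst φ w))
    · exact Or.inr ⟨s, hs, _, subst_subst φ ψ s⟩

theorem notMem_longOrInstance {n : ℕ} {S : Set SWord} (hS : ∀ s ∈ S, s.letters.length = n)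
    {w : SWord} (hw : w.letters.length = n) (h : ∀ s ∈ S, ∀ f : ℕ → ℕ, w ≠ rename f s) :
    w ∉ longOrInstance n S := by
  rintro (h' | ⟨s, hs, φ, rfl⟩)
  · omega
  · obtain ⟨f, hf⟩ := exists_subst_eq_rename φ (w := s) (by rw [hw, hS s hs])
    exact h s hs f hf

/-- The congruence of having the same prefix of length `n`. -/
def prefixCon (n : ℕ) : Con SWord where
  r u v := u.letters.take n = v.letters.take n
  iseqv := ⟨fun _ => rfl, fun h => h.symm, fun h k => h.trans k⟩
  mul' := by
    intro w x y z h k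
    have h₁ : ∀ a b : List ℕ, (a ++ b).take n = (a.take n ++ b.take n).take n := by
      intro a b
      rw [List.take_append, List.take_append, List.take_take, min_self, List.take_take,
        List.length_take]
      congr 1
      rcases le_total n a.length with hn | hn
      · simp [hn]
      · rw [min_eq_right hn, min_eq_left (Nat.sub_le _ _)]
    rw [letters_mul, letters_mul, h₁, h, k, ← h₁]

theorem prefixCon_iff {n : ℕ} {u v : SWord} :
    prefixCon n u v ↔ u.letters.take n = v.letters.take n := Iff.rfl

/-- Letters go to nonempty words, so the first `n` letters of an image depend only on the first `n`
letters of the word. -/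
theorem fullyInvariant_prefixCon (n : ℕ) : FullyInvariant (prefixCon n) := by
  have key : ∀ (φ : ℕ → SWord) (l : List ℕ), (l.flatMap fun i => (φ i).letters).take n =
      ((l.take n).flatMap fun i => (φ i).letters).take n := by
    intro φ l
    induction n generalizing l with
    | zero => simp
    | succ n ih =>
      cases l with
      | nil => rfl
      | cons a l =>
        rw [List.take_succ_cons, List.flatMap_cons, List.flatMap_cons, List.take_append,
          List.take_append]
        congr 1
        have hpos := (φ a).letters_length_pos
        obtain ⟨m, hm⟩ : ∃ m, n + 1 - (φ a).letters.length = min m n :=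
          ⟨n + 1 - (φ a).letters.length, by omega⟩
        rw [hm, ← List.take_take, ih, List.take_take]
  intro φ u v h
  rw [prefixCon_iff] at h ⊢
  rw [letters_subst, letters_subst, key, h, ← key]

/-- Words of length `n` are related if they have the same content, and so are any two longer
words. -/
def lengthCon (n : ℕ) : Con SWord where
  r u v := u = v ∨ (n < u.letters.length ∧ n < v.letters.length) ∨
    u.letters.length = n ∧ v.letters.length = n ∧ u.content = v.content
  iseqv := by
    refine ⟨fun _ => Or.inl rfl, ?_, ?_⟩
    · rintro u v (rfl | ⟨h₁, h₂⟩ | ⟨h₁, h₂, h₃⟩)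
      · exact Or.inl rfl
      · exact Or.inr (Or.inl ⟨h₂, h₁⟩)
      · exact Or.inr (Or.inr ⟨h₂, h₁, h₃.symm⟩)
    · rintro u v w (rfl | ⟨h₁, h₂⟩ | ⟨h₁, h₂, h₃⟩) h
      · exact h
      · rcases h with rfl | ⟨h₃, h₄⟩ | ⟨h₃, h₄, -⟩
        · exact Or.inr (Or.inl ⟨h₁, h₂⟩)
        · exact Or.inr (Or.inl ⟨h₁, h₄⟩)
        · omega
      · rcases h with rfl | ⟨h₄, h₅⟩ | ⟨h₄, h₅, h₆⟩
        · exact Or.inr (Or.inr ⟨h₁, h₂, h₃⟩)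
        · omega
        · exact Or.inr (Or.inr ⟨h₁, h₅, h₃.trans h₆⟩)
  mul' := by
    intro w x y z h k
    have := w.letters_length_pos
    have := x.letters_length_pos
    have := y.letters_length_pos
    have := z.letters_length_pos
    rcases h with rfl | h
    · rcases k with rfl | k
      · exact Or.inl rfl
      · refine Or.inr (Or.inl ?_)
        simp only [letters_mul, List.length_append]
        omega
    · refine Or.inr (Or.inl ?_)
      simp only [letters_mul, List.length_append]
      rcases k with rfl | k <;> omega

/-- An image of a word of length `n` keeps length `n` only if every occurring letter goes to a
letter, a condition on the content alone. -/
theorem fullyInvariant_lengthCon (n : ℕ) : FullyInvariant (lengthCon n) := by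
  rintro φ u v (rfl | ⟨h₁, h₂⟩ | ⟨h₁, h₂, h₃⟩)
  · exact Or.inl rfl
  · exact Or.inr (Or.inl ⟨h₁.trans_le (length_le_subst φ u), h₂.trans_le (length_le_subst φ v)⟩)
  · refine Or.inr ?_
    have key : ∀ {u v : SWord}, u.letters.length = n → v.letters.length = n →
        u.content = v.content → (subst φ u).letters.length = n →
        (subst φ v).letters.length = n := by
      intro u v hu hv huv h
      have h₄ : subst φ v = rename (fun i => (φ i).head) v := subst_eq_rename_head fun i hi =>
        length_subst_eq φ (w := u) (by rw [h, hu]) (huv ▸ hi)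
      rw [h₄, letters_rename, List.length_map, hv]
    have hu := h₁ ▸ length_le_subst φ u
    have hv := h₂ ▸ length_le_subst φ v
    by_cases h : (subst φ u).letters.length = n
    · exact Or.inr ⟨h, key h₁ h₂ h₃ h, fullyInvariant_contentCon φ h₃⟩
    · have h' : (subst φ v).letters.length ≠ n := fun h' => h (key h₂ h₁ h₃.symm h')
      exact Or.inl ⟨by omega, by omega⟩

/-- Words of length `n` are related by the permutations of the positions in `K`, and any two longer
words are related. -/
def positionCon {n : ℕ} (K : Subgroup (Equiv.Perm (Fin n))) : Con SWord where
  r u v := u = v ∨ (n < u.letters.length ∧ n < v.letters.length) ∨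
    ∃ f : Fin n → ℕ, ∃ σ ∈ K, u.letters = List.ofFn f ∧ v.letters = List.ofFn (f ∘ σ)
  iseqv := by
    refine ⟨fun _ => Or.inl rfl, ?_, ?_⟩
    · rintro u v (rfl | ⟨h₁, h₂⟩ | ⟨f, σ, hσ, h₁, h₂⟩)
      · exact Or.inl rfl
      · exact Or.inr (Or.inl ⟨h₂, h₁⟩)
      · refine Or.inr (Or.inr ⟨f ∘ σ, σ⁻¹, inv_mem hσ, h₂, ?_⟩)
        rw [h₁]
        congr 1
        funext i
        simp
    · rintro u v w (rfl | ⟨h₁, h₂⟩ | ⟨f, σ, hσ, h₁, h₂⟩) h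
      · exact h
      · rcases h with rfl | ⟨h₃, h₄⟩ | ⟨f, σ, hσ, h₃, h₄⟩
        · exact Or.inr (Or.inl ⟨h₁, h₂⟩)
        · exact Or.inr (Or.inl ⟨h₁, h₄⟩)
        · rw [h₃, List.length_ofFn] at h₂
          omega
      · rcases h with rfl | ⟨h₃, h₄⟩ | ⟨f', π, hπ, h₃, h₄⟩
        · exact Or.inr (Or.inr ⟨f, σ, hσ, h₁, h₂⟩)
        · rw [h₂, List.length_ofFn] at h₃
          omega
        · obtain rfl : f ∘ σ = f' := List.ofFn_injective (h₂.symm.trans h₃)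
          exact Or.inr (Or.inr ⟨f, σ * π, mul_mem hσ hπ, h₁, h₄⟩)
  mul' := by
    intro w x y z h k
    have hw := w.letters_length_pos
    have hx := x.letters_length_pos
    have hy := y.letters_length_pos
    have hz := z.letters_length_pos
    have key : ∀ {a b : SWord}, ((n < a.letters.length ∧ n < b.letters.length) ∨
        ∃ f : Fin n → ℕ, ∃ σ ∈ K, a.letters = List.ofFn f ∧ b.letters = List.ofFn (f ∘ σ)) →
        n ≤ a.letters.length ∧ n ≤ b.letters.length := by
      rintro a b (⟨h₁, h₂⟩ | ⟨f, σ, -, h₁, h₂⟩)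
      · exact ⟨h₁.le, h₂.le⟩
      · rw [h₁, h₂]
        simp
    rcases h with rfl | h
    · rcases k with rfl | k
      · exact Or.inl rfl
      · have := key k
        refine Or.inr (Or.inl ?_)
        simp only [letters_mul, List.length_append]
        omega
    · have := key h
      refine Or.inr (Or.inl ?_)
      simp only [letters_mul, List.length_append]
      omega

theorem positionCon_mono {n : ℕ} {K L : Subgroup (Equiv.Perm (Fin n))} (h : K ≤ L) :
    positionCon K ≤ positionCon L := by
  rintro u v (rfl | h₁ | ⟨f, σ, hσ, h₁⟩)
  · exact Or.inl rfl
  · exact Or.inr (Or.inl h₁)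
  · exact Or.inr (Or.inr ⟨f, σ, h hσ, h₁⟩)

/-- A substitution either renames letters, which commutes with permuting positions, or makes both
words longer than `n`. -/
theorem fullyInvariant_positionCon {n : ℕ} (K : Subgroup (Equiv.Perm (Fin n))) :
    FullyInvariant (positionCon K) := by
  rintro φ u v (rfl | ⟨h₁, h₂⟩ | ⟨f, σ, hσ, h₁, h₂⟩)
  · exact Or.inl rfl
  · exact Or.inr (Or.inl ⟨h₁.trans_le (length_le_subst φ u), h₂.trans_le (length_le_subst φ v)⟩)
  · refine Or.inr ?_
    have hperm : u.letters.Perm v.letters := by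
      rw [h₁, h₂]
      exact (Equiv.Perm.ofFn_comp_perm σ f).symm
    have hperm' : (subst φ u).letters.Perm (subst φ v).letters := by
      rw [letters_subst, letters_subst]
      exact hperm.flatMap_right _
    have hun : u.letters.length = n := by rw [h₁, List.length_ofFn]
    by_cases h : (subst φ u).letters.length ≤ n
    · refine Or.inr ⟨fun i => (φ (f i)).head, σ, hσ, ?_, ?_⟩
      · rw [subst_eq_rename_head fun i => length_subst_eq φ (w := u) (by rw [hun]; exact h),
          letters_rename, h₁, List.map_ofFn]
        rfl
      · rw [subst_eq_rename_head fun i hi => length_subst_eq φ (w := u) (by rw [hun]; exact h)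
            (content_eq_of_perm hperm ▸ hi), letters_rename, h₂, List.map_ofFn]
        rfl
    · refine Or.inl ⟨by omega, ?_⟩
      rw [← hperm'.length_eq]
      omega

end SWord

/-! ### Modularity forces all permutations of four letters. -/

/-- The group generated by the double transposition `(0 1)(2 3)`. -/
def pairSwapGroup : Subgroup (Equiv.Perm (Fin 4)) where
  carrier := {1, Equiv.swap 0 1 * Equiv.swap 2 3}
  one_mem' := Or.inl rfl
  mul_mem' := by
    rintro _ _ (rfl | rfl) (rfl | rfl)
    · exact Or.inl (by decide)
    · exact Or.inr (by decide)
    · exact Or.inr (by decide)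
    · exact Or.inl (by decide)
  inv_mem' := by
    rintro _ (rfl | rfl)
    · exact Or.inl (by decide)
    · exact Or.inr (by decide)

/-- The normal Klein subgroup of the symmetric group of degree 4. -/
def kleinGroup : Subgroup (Equiv.Perm (Fin 4)) where
  carrier := {1, Equiv.swap 0 1 * Equiv.swap 2 3, Equiv.swap 0 2 * Equiv.swap 1 3,
    Equiv.swap 0 3 * Equiv.swap 1 2}
  one_mem' := Or.inl rfl
  mul_mem' := by
    have : ∀ x ∈ ({1, Equiv.swap 0 1 * Equiv.swap 2 3, Equiv.swap 0 2 * Equiv.swap 1 3,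
        Equiv.swap 0 3 * Equiv.swap 1 2} : Finset (Equiv.Perm (Fin 4))),
        ∀ y ∈ ({1, Equiv.swap 0 1 * Equiv.swap 2 3, Equiv.swap 0 2 * Equiv.swap 1 3,
        Equiv.swap 0 3 * Equiv.swap 1 2} : Finset (Equiv.Perm (Fin 4))),
        x * y ∈ ({1, Equiv.swap 0 1 * Equiv.swap 2 3, Equiv.swap 0 2 * Equiv.swap 1 3,
        Equiv.swap 0 3 * Equiv.swap 1 2} : Finset (Equiv.Perm (Fin 4))) := by decide
    intro a b ha hb
    have := this a (by simpa using ha) b (by simpa using hb)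
    simpa using this
  inv_mem' := by
    have : ∀ x ∈ ({1, Equiv.swap 0 1 * Equiv.swap 2 3, Equiv.swap 0 2 * Equiv.swap 1 3,
        Equiv.swap 0 3 * Equiv.swap 1 2} : Finset (Equiv.Perm (Fin 4))), x⁻¹ = x := by decide
    intro a ha
    rw [this a (by simpa using ha)]
    exact ha

theorem pairSwapGroup_le_kleinGroup : pairSwapGroup ≤ kleinGroup := by
  rintro _ (rfl | rfl)
  · exact Or.inl rfl
  · exact Or.inr (Or.inl rfl)

/-- The subgroup lattice of the symmetric group of degree 4 is not modular: the middle transposition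
and `(0 1)(2 3)` together generate the whole Klein group. Modularity of `c` therefore forces it to
contain a Klein rearrangement outside `pairSwapGroup`. -/
theorem rel_swap_pairs_of_swap₂₃ {c : Con SWord} (hc : FullyInvariant c) (hm : IsModularFIC c)
    (h : ∀ x y z t : SWord, c (x * (y * (z * t))) (x * (z * (y * t)))) :
    (∀ x y z t : SWord, c (x * (y * (z * t))) (z * (t * (x * y)))) ∨
      ∀ x y z t : SWord, c (x * (y * (z * t))) (t * (z * (y * x))) := by
  let w (i j k l : ℕ) : SWord := letter i * (letter j * (letter k * letter l))
  have hw : ∀ {i j k l : ℕ} {a : SWord}, a.letters = [i, j, k, l] → a = w i j k l :=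
    fun ha => letters_injective ha
  obtain ⟨a, ha, d, hd, had, hb⟩ := hm.exists_rel (g := positionCon pairSwapGroup)
    (b := positionCon kleinGroup) (fullyInvariant_positionCon _) (fullyInvariant_positionCon _)
    (positionCon_mono pairSwapGroup_le_kleinGroup)
    (C := {w 0 1 2 3, w 1 0 3 2}) (u := w 0 1 2 3) (v := w 2 3 0 1) (by
      rintro a d (rfl | ⟨h₁, -⟩ | ⟨f, σ, hσ, h₁, h₂⟩) ha
      · exact ha
      · rcases ha with rfl | rfl <;> exact absurd h₁ (by decide)
      · rcases ha with rfl | rfl <;> rcases hσ with rfl | rfl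
        · exact Or.inl (letters_injective (h₂.trans h₁.symm))
        · refine Or.inr (hw ?_)
          have h₁' : [0, 1, 2, 3] = [f 0, f 1, f 2, f 3] := h₁
          have h₂' : d.letters = [f 1, f 0, f 3, f 2] := h₂
          simp only [List.cons.injEq, and_true] at h₁'
          rw [h₂', ← h₁'.1, ← h₁'.2.1, ← h₁'.2.2.1, ← h₁'.2.2.2]
        · exact Or.inr (letters_injective (h₂.trans h₁.symm))
        · refine Or.inl (hw ?_)
          have h₁' : [1, 0, 3, 2] = [f 0, f 1, f 2, f 3] := h₁
          have h₂' : d.letters = [f 1, f 0, f 3, f 2] := h₂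
          simp only [List.cons.injEq, and_true] at h₁'
          rw [h₂', ← h₁'.1, ← h₁'.2.1, ← h₁'.2.2.1, ← h₁'.2.2.2])
    (Or.inl rfl) (by
      rintro (h | h) <;> exact absurd (congrArg letters h) (by decide))
    (by
      have h₁ : (c ⊔ positionCon pairSwapGroup) (w 0 1 2 3) (w 0 2 1 3) :=
        (le_sup_left : c ≤ _) (h _ _ _ _)
      have h₂ : (c ⊔ positionCon pairSwapGroup) (w 0 2 1 3) (w 2 0 3 1) :=
        (le_sup_right : positionCon pairSwapGroup ≤ _)
          (Or.inr (Or.inr ⟨![0, 2, 1, 3], _, Or.inr rfl, by decide, by decide⟩))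
      have h₃ : (c ⊔ positionCon pairSwapGroup) (w 2 0 3 1) (w 2 3 0 1) :=
        (le_sup_left : c ≤ _) (h _ _ _ _)
      exact Con.trans _ h₁ (Con.trans _ h₂ h₃))
    (Or.inr (Or.inr ⟨![0, 1, 2, 3], _, Or.inr (Or.inr (Or.inl rfl)), by decide, by decide⟩))
  have hd' : d = w 2 3 0 1 ∨ d = w 3 2 1 0 := by
    rcases hb with rfl | ⟨h₁, -⟩ | ⟨f, σ, hσ, h₁, h₂⟩
    · exact absurd ha hd
    · rcases ha with rfl | rfl <;> exact absurd h₁ (by decide)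
    · have key : ∀ {i j k l : ℕ}, a = w i j k l →
          d ∈ ({w i j k l, w j i l k, w k l i j, w l k j i} : Set SWord) := by
        rintro i j k l rfl
        have h₁' : [i, j, k, l] = [f 0, f 1, f 2, f 3] := h₁
        simp only [List.cons.injEq, and_true] at h₁'
        obtain ⟨rfl, rfl, rfl, rfl⟩ := h₁'
        rcases hσ with rfl | rfl | rfl | rfl
        · exact Or.inl (hw h₂)
        · exact Or.inr (Or.inl (hw h₂))
        · exact Or.inr (Or.inr (Or.inl (hw h₂)))
        · exact Or.inr (Or.inr (Or.inr (hw h₂)))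
      rcases ha with ha | ha
      · rcases key ha with h | h | h | h
        · exact absurd (Or.inl h) hd
        · exact absurd (Or.inr h) hd
        · exact Or.inl h
        · exact Or.inr h
      · rcases key ha with h | h | h | h
        · exact absurd (Or.inr h) hd
        · exact absurd (Or.inl h) hd
        · exact Or.inr h
        · exact Or.inl h
  rcases ha with rfl | rfl <;> rcases hd' with rfl | rfl
  · exact Or.inl fun x y z t => by
      simpa only [w, map_mul, subst_letter, vals] using hc (vals x y z t) had
  · exact Or.inr fun x y z t => by
      simpa only [w, map_mul, subst_letter, vals] using hc (vals x y z t) had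
  · exact Or.inr fun x y z t => by
      simpa only [w, map_mul, subst_letter, vals] using hc (vals y x t z) had
  · exact Or.inl fun x y z t => by
      simpa only [w, map_mul, subst_letter, vals] using hc (vals y x t z) had

/-- Both rearrangements exchange the first two positions with the last two, so conjugation carries
the known swap at the front to the back. -/
theorem HasSwaps.of_modular_of_swap_left {c : Con SWord} (hc : FullyInvariant c)
    (hm : IsModularFIC c) (h : ∀ x y z : SWord, c (x * (y * z)) (y * (x * z))) : HasSwaps c := by
  refine .of_swap_left h fun x y z t => ?_
  rcases rel_swap_pairs_of_swap₂₃ hc hm fun x y z t => c.mul (c.refl x) (h y z t) with h' | h'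
  · exact c.trans (h' x y z t) (c.trans (h _ _ _) (h' _ _ _ _))
  · exact c.trans (h' x y z t) (c.trans (h _ _ _) (h' _ _ _ _))

theorem HasSwaps.of_modular_of_swap_right {c : Con SWord} (hc : FullyInvariant c)
    (hm : IsModularFIC c) (h : ∀ x y z : SWord, c (x * (y * z)) (x * (z * y))) : HasSwaps c := by
  have h₃₄ : ∀ x y z t : SWord, c (x * (y * (z * t))) (x * (y * (t * z))) := fun x y z t =>
    c.mul (c.refl x) (h y z t)
  have h₂₃ : ∀ x y z t : SWord, c (x * (y * (z * t))) (x * (z * (y * t))) := by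
    intro x y z t
    refine c.trans (y := x * (z * (t * y))) ?_ (h₃₄ x z t y)
    simpa only [mul_assoc] using h x y (z * t)
  refine .of_swap_right h fun x y z t => ?_
  rcases rel_swap_pairs_of_swap₂₃ hc hm h₂₃ with h' | h'
  · exact c.trans (h' x y z t) (c.trans (h₃₄ _ _ _ _) (h' _ _ _ _))
  · exact c.trans (h' x y z t) (c.trans (h₃₄ _ _ _ _) (h' _ _ _ _))

/-! ### Words with repeated letters. -/

namespace SWord

/-- The multiset of letters of a word. -/
def occ (w : SWord) : Multiset ℕ := w.letters

theorem occ_mul (u v : SWord) : (u * v).occ = u.occ + v.occ := by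
  simp [occ, letters_mul]

end SWord

namespace HasSwaps

variable {c : Con SWord}

theorem rel_of_occ (h : HasSwaps c) {u v : SWord} (hlen : 4 ≤ u.letters.length)
    (huv : u.occ = v.occ) : c u v := h.rel_of_perm hlen (Multiset.coe_eq_coe.1 huv)

/-- On words of length 4, `b` fixes the content and the first three letters; `g` is its restriction
to an ideal containing `2010` and `2011` but not `0120`. Rearrangements lead from `0120` to `2010`
and from `2011` to `0121`, so `c` must relate `0120` directly to `0121` or `0122`. Either one moves
a square. -/
theorem rel_square (hs : HasSwaps c) (hc : FullyInvariant c) (hm : IsModularFIC c)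
    (x y z : SWord) : c (x * x * y * z) (x * y * y * z) := by
  let w (i j k l : ℕ) : SWord := letter i * (letter j * (letter k * letter l))
  let S : Set SWord := {w 2 0 1 0, w 2 0 1 1}
  have hS : ∀ s ∈ S, s.letters.length = 4 := by rintro s (rfl | rfl) <;> rfl
  have hJ := isFIIdeal_longOrInstance hS
  have hk : FullyInvariant (lengthCon 4 ⊓ prefixCon 3) :=
    (fullyInvariant_lengthCon 4).inf (fullyInvariant_prefixCon 3)
  have hu : w 0 1 2 0 ∉ longOrInstance 4 S := by
    refine notMem_longOrInstance hS rfl ?_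
    rintro s (rfl | rfl) f hf
    · have this : [0, 1, 2, 0] = [f 2, f 0, f 1, f 0] := congrArg letters hf
      simp only [List.cons.injEq, and_true] at this
      omega
    · have this : [0, 1, 2, 0] = [f 2, f 0, f 1, f 1] := congrArg letters hf
      simp only [List.cons.injEq, and_true] at this
      omega
  obtain ⟨a, rfl, d, hd, had, hb⟩ := hm.exists_rel (g := reesCon hJ (lengthCon 4 ⊓ prefixCon 3))
    (b := lengthCon 4 ⊓ prefixCon 3) (hk.reesCon hJ) hk (reesCon_le _ _)
    (C := {w 0 1 2 0}) (u := w 0 1 2 0) (v := w 0 1 2 1)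
    (by
      rintro a d (rfl | ⟨ha, -, -⟩) rfl
      · rfl
      · exact absurd ha hu)
    rfl (fun h => absurd (congrArg letters h) (by decide))
    (by
      set T := c ⊔ reesCon hJ (lengthCon 4 ⊓ prefixCon 3) with hT
      have h₁ : T (w 0 1 2 0) (w 2 0 1 0) := (le_sup_left : c ≤ T)
        (hs.rel_of_perm (by decide) (by decide))
      have h₂ : T (w 2 0 1 0) (w 2 0 1 1) := (le_sup_right : reesCon hJ _ ≤ T)
        (Or.inr ⟨Or.inr ⟨_, Or.inl rfl, letter, (subst_id _).symm⟩,
          Or.inr ⟨_, Or.inr rfl, letter, (subst_id _).symm⟩,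
          Or.inr (Or.inr ⟨rfl, rfl, by decide⟩), rfl⟩)
      have h₃ : T (w 2 0 1 1) (w 0 1 2 1) := (le_sup_left : c ≤ T)
        (hs.rel_of_perm (by decide) (by decide))
      exact T.trans h₁ (T.trans h₂ h₃))
    ⟨Or.inr (Or.inr ⟨rfl, rfl, by decide⟩), rfl⟩
  obtain ⟨hb, hpre⟩ := hb
  have hd' : d = w 0 1 2 1 ∨ d = w 0 1 2 2 := by
    rcases hb with rfl | ⟨h₁, -⟩ | ⟨-, h₁, h₂⟩
    · exact absurd rfl hd
    · exact absurd h₁ (by decide)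
    · obtain ⟨l₀, l₁, l₂, l₃, hl⟩ : ∃ l₀ l₁ l₂ l₃, d.letters = [l₀, l₁, l₂, l₃] :=
        List.length_eq_four.1 h₁
      have hpre : [0, 1, 2] = d.letters.take 3 := hpre
      rw [hl] at hpre
      simp only [List.take_succ_cons, List.take_zero, List.cons.injEq, and_true] at hpre
      obtain ⟨rfl, rfl, rfl⟩ := hpre
      have hl₃ : l₃ ∈ (w 0 1 2 0).content := by
        rw [show (w 0 1 2 0).content = d.content from h₂, mem_content, hl]
        simp
      have : l₃ = 2 ∨ l₃ = 1 ∨ l₃ = 0 := by simpa [w] using hl₃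
      rcases this with rfl | rfl | rfl
      · exact Or.inr (letters_injective hl)
      · exact Or.inl (letters_injective hl)
      · exact absurd (letters_injective hl) hd
  have hlen : ∀ x y z t : SWord, 4 ≤ (x * y * z * t).letters.length := by
    intro x y z t
    have := x.letters_length_pos
    have := y.letters_length_pos
    have := z.letters_length_pos
    have := t.letters_length_pos
    simp only [letters_mul, List.length_append]
    omega
  rcases hd' with rfl | rfl
  · refine c.trans (hs.rel_of_occ (hlen _ _ _ _) ?_) (c.trans (hc (vals x y z z) had) (c.symm
      (hs.rel_of_occ (hlen _ _ _ _) ?_)))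
    · simp only [w, map_mul, subst_letter, vals, occ_mul]; abel
    · simp only [w, map_mul, subst_letter, vals, occ_mul]; abel
  · refine c.trans (hs.rel_of_occ (hlen _ _ _ _) ?_) (c.trans (hc (vals x z y z) had) (c.symm
      (hs.rel_of_occ (hlen _ _ _ _) ?_)))
    · simp only [w, map_mul, subst_letter, vals, occ_mul]; abel
    · simp only [w, map_mul, subst_letter, vals, occ_mul]; abel

/-- The ideal defining `g` contains `u'` but not `u`, and the chain `u, u', u'u', uu` leaves `{u}`.
The resulting `q ≠ u` shares the first three letters of `u`, so it must be longer. -/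
theorem _root_.IsModularFIC.exists_rel_long (hm : IsModularFIC c)
    {u u' : SWord} (hu : u.letters.length = 3) (hu' : u'.letters.length = 3)
    (huu' : c u u') (hne : ∀ f : ℕ → ℕ, u ≠ rename f u') :
    ∃ q, c u q ∧ 4 ≤ q.letters.length ∧ q.content = u.content := by
  have hS : ∀ s ∈ ({u'} : Set SWord), s.letters.length = 3 := by
    rintro s rfl
    exact hu'
  have hJ := isFIIdeal_longOrInstance hS
  have hk : FullyInvariant (prefixCon 3 ⊓ contentCon) :=
    (fullyInvariant_prefixCon 3).inf fullyInvariant_contentCon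
  have huJ : u ∉ longOrInstance 3 {u'} :=
    notMem_longOrInstance hS hu (by rintro s rfl; exact hne)
  have hmul : ∀ {w : SWord}, w.letters.length = 3 → (prefixCon 3 ⊓ contentCon) w (w * w) := by
    intro w hw
    refine ⟨?_, ?_⟩
    · show w.letters.take 3 = (w * w).letters.take 3
      rw [letters_mul, List.take_append_of_le_length hw.ge]
    · show w.content = (w * w).content
      simp
  obtain ⟨a, rfl, q, hq, haq, hb⟩ := hm.exists_rel (g := reesCon hJ (prefixCon 3 ⊓ contentCon))
    (b := prefixCon 3 ⊓ contentCon) (hk.reesCon hJ) hk (reesCon_le _ _)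
    (C := {u}) (u := u) (v := u * u)
    (by
      rintro a d (rfl | ⟨ha, -, -⟩) rfl
      · rfl
      · exact absurd ha huJ)
    rfl (fun h => by
      have := congrArg (fun w => w.letters.length) (show u * u = u from h)
      simp only [letters_mul, List.length_append] at this
      omega)
    (by
      set T := c ⊔ reesCon hJ (prefixCon 3 ⊓ contentCon) with hT
      have h₁ : T u u' := (le_sup_left : c ≤ T) huu'
      have h₂ : T u' (u' * u') := (le_sup_right : reesCon hJ _ ≤ T)
        (Or.inr ⟨Or.inr ⟨_, rfl, letter, (subst_id _).symm⟩,
          Or.inl (by rw [letters_mul, List.length_append]; omega), hmul hu'⟩)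
      have h₃ : T (u * u) (u' * u') := (le_sup_left : c ≤ T)
        (c.mul huu' huu')
      exact T.trans h₁ (T.trans h₂ (T.symm h₃)))
    (hmul hu)
  refine ⟨q, haq, ?_, hb.2.symm⟩
  by_contra hlen
  refine hq (letters_injective ?_)
  have h₁ : a.letters.take 3 = q.letters.take 3 := hb.1
  rw [List.take_of_length_le (by omega), List.take_of_length_le (by omega)] at h₁
  exact h₁.symm

end HasSwaps

namespace SWord

theorem not_nodup_mul_right {u : SWord} (v : SWord) (h : ¬ u.letters.Nodup) :
    ¬ (u * v).letters.Nodup := fun h' => h (List.Nodup.of_append_left (by rwa [letters_mul] at h'))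

theorem not_nodup_mul_left {u : SWord} (v : SWord) (h : ¬ u.letters.Nodup) :
    ¬ (v * u).letters.Nodup := fun h' => h (List.Nodup.of_append_right (by rwa [letters_mul] at h'))

end SWord

namespace HasSwaps

variable {c : Con SWord}

/-- The words `x²y(tz) ≈ xy²tz` and `x²(yt)z ≈ x(yt)²z` have a common left side, so a letter `t`
accompanying a square may be doubled. Length 5 keeps all factors nonempty. -/
theorem rel_mul_letter (hs : HasSwaps c) (hsq : ∀ x y z : SWord, c (x * x * y * z) (x * y * y * z))
    {w : SWord} (hlen : 5 ≤ w.letters.length) (hnd : ¬ w.letters.Nodup) {t : ℕ}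
    (ht : t ∈ w.content) : c w (w * letter t) := by
  have hpos := fun x : SWord => x.letters_length_pos
  have hfour : ∀ x y z t : SWord, 4 ≤ (x * y * z * t).letters.length := by
    intro x y z t
    have := hpos x
    have := hpos y
    have := hpos z
    have := hpos t
    simp only [letters_mul, List.length_append]
    omega
  have hsq' : ∀ {u v x y z : SWord}, u.occ = (x * x * y * z).occ → v.occ = (x * y * y * z).occ →
      c u v := by
    intro u v x y z hu hv
    refine c.trans (c.symm (hs.rel_of_occ (hfour x x y z) hu.symm)) (c.trans (hsq x y z) ?_)
    exact hs.rel_of_occ (hfour _ _ _ _) hv.symm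
  have hsq₂ : ∀ {u v x y t z : SWord}, u.occ = (x * y * y * t * z).occ →
      v.occ = (x * y * y * t * t * z).occ → c u v := by
    intro u v x y t z hu hv
    have h₁ : c (x * x * y * t * z) u := hsq' (x := x) (y := y) (z := t * z)
      (by simp only [occ_mul]; abel) (by simp only [hu, occ_mul]; abel)
    have h₂ : c (x * x * y * t * z) v := hsq' (x := x) (y := y * t) (z := z)
      (by simp only [occ_mul]; abel) (by simp only [hv, occ_mul]; abel)
    exact c.trans (c.symm h₁) h₂
  obtain ⟨y, l, hl⟩ := exists_perm_of_not_nodup hnd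
  have hlen' := hl.length_eq
  simp only [List.length_cons] at hlen'
  have hocc : ∀ {l' : List ℕ} {v : SWord}, l.Perm l' → v.letters = y :: y :: l' → w.occ = v.occ := by
    intro l' v hll hv
    refine Multiset.coe_eq_coe.2 (hl.trans ?_)
    rw [hv]
    exact (hll.cons y).cons y
  by_cases htl : t ∈ l
  · obtain ⟨m, hm⟩ : ∃ m, l.Perm (t :: m) := ⟨_, List.perm_cons_erase htl⟩
    have hml := hm.length_eq
    rcases m with _ | ⟨a, m⟩
    · simp at hml; omega
    obtain ⟨z, hz⟩ := exists_letters (l := m) (by rintro rfl; simp at hml; omega)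
    have ho : w.occ = (letter y * (letter y * (letter t * (letter a * z)))).occ :=
      hocc hm (by simp [letters_mul, hz])
    refine hsq₂ (x := letter a) (y := letter y) (t := letter t) (z := z) ?_ ?_
    · rw [ho]; simp only [occ_mul]; abel
    · rw [occ_mul, ho]; simp only [occ_mul]; abel
  -- If `t` occurs only in the square, the square is first shifted to another letter `x`, leaving a
  -- single `t` to be doubled.
  · obtain rfl : t = y := by
      rw [mem_content, hl.mem_iff] at ht
      simpa [htl] using ht
    rcases l with _ | ⟨x, _ | ⟨z, m⟩⟩
    · simp at hlen'; omega
    · simp at hlen'; omega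
    obtain ⟨s, hs'⟩ := exists_letters (l := m) (by rintro rfl; simp at hlen'; omega)
    have ho : w.occ = (letter t * (letter t * (letter x * (letter z * s)))).occ :=
      hocc (.refl _) (by simp [letters_mul, hs'])
    let v := letter x * letter x * letter t * letter z * s
    have h₁ : c v w := hsq' (x := letter x) (y := letter t) (z := letter z * s)
      (by simp only [v, occ_mul]; abel) (by rw [ho]; simp only [occ_mul]; abel)
    have h₂ : c v (v * letter t) := hsq₂ (x := letter z) (y := letter x) (t := letter t) (z := s)
      (by simp only [v, occ_mul]; abel) (by simp only [v, occ_mul]; abel)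
    have h₃ : c (v * letter t) (w * letter t) := c.mul h₁ (c.refl _)
    exact c.trans (c.symm h₁) (c.trans h₂ h₃)

theorem rel_of_content_eq_of_five_le (hs : HasSwaps c)
    (hsq : ∀ x y z : SWord, c (x * x * y * z) (x * y * y * z)) {v w : SWord}
    (hv : 5 ≤ v.letters.length) (hv' : ¬ v.letters.Nodup)
    (hw : 5 ≤ w.letters.length) (hw' : ¬ w.letters.Nodup) (h : v.content = w.content) : c v w := by
  have key : ∀ {w : SWord}, 5 ≤ w.letters.length → ¬ w.letters.Nodup → ∀ v : SWord,
      v.content ⊆ w.content → c w (w * v) := by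
    intro w hw hw' v
    have hlen : ∀ v, 5 ≤ (w * v).letters.length := fun v => by
      rw [letters_mul, List.length_append]; omega
    induction v using SWord.inductionOn with
    | letter i => exact fun h => hs.rel_mul_letter hsq hw hw' (h (by simp))
    | mul i v ih =>
      intro h
      rw [content_mul] at h
      refine c.trans (ih (Finset.union_subset_right h)) (c.trans
        (hs.rel_mul_letter hsq (t := i) (hlen v) (not_nodup_mul_right v hw') ?_)
        (hs.rel_of_occ ?_ ?_))
      · rw [content_mul]
        exact Finset.mem_union_left _ (h (by simp))
      · have := hlen v
        rw [letters_mul, List.length_append]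
        omega
      · simp only [occ_mul]; abel
  refine c.trans (key hv hv' w h.ge) (c.trans (hs.rel_of_occ ?_ ?_) (c.symm (key hw hw' v h.le)))
  · rw [letters_mul, List.length_append]
    omega
  · simp only [occ_mul]; abel

end HasSwaps

/-- The ideal of the words of length at least 4 with repeated letters and of the substitution
instances of `u`. -/
def repeatIdeal (u : SWord) : Set SWord :=
  {w | 4 ≤ w.letters.length ∧ ¬ w.letters.Nodup ∨ ∃ φ, w = subst φ u}

theorem isFIIdeal_repeatIdeal {u : SWord} (hu : u.letters.length = 3) (hnd : ¬ u.letters.Nodup) :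
    IsFIIdeal (repeatIdeal u) := by
  have key : ∀ {w}, w ∈ repeatIdeal u → 3 ≤ w.letters.length ∧ ¬ w.letters.Nodup := by
    rintro w (⟨h₁, h₂⟩ | ⟨φ, rfl⟩)
    · exact ⟨by omega, h₂⟩
    · exact ⟨hu ▸ length_le_subst φ u, not_nodup_subst φ hnd⟩
  refine ⟨fun {a} b ha => Or.inl ⟨?_, not_nodup_mul_left b (key ha).2⟩,
    fun {a} b ha => Or.inl ⟨?_, not_nodup_mul_right b (key ha).2⟩, ?_⟩
  · have := (key ha).1
    have := b.letters_length_pos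
    rw [letters_mul, List.length_append]
    omega
  · have := (key ha).1
    have := b.letters_length_pos
    rw [letters_mul, List.length_append]
    omega
  · rintro w φ (⟨h₁, h₂⟩ | ⟨ψ, rfl⟩)
    · exact Or.inl ⟨h₁.trans (length_le_subst φ w), not_nodup_subst φ h₂⟩
    · exact Or.inr ⟨_, subst_subst φ ψ u⟩

/-- Trading an instance of `u` for the same instance of the longer word `q` lengthens short words of
the ideal to length at least 5 without changing the content. Repetitions persist because the length
exceeds the number of letters. -/
theorem HasSwaps.rel_of_mem_repeatIdeal {c : Con SWord} (hs : HasSwaps c) (hc : FullyInvariant c)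
    (hm : IsModularFIC c) {u u' : SWord} (hu : u.letters.length = 3) (hnd : ¬ u.letters.Nodup)
    (hu' : u'.letters.length = 3) (huu' : c u u') (hne : ∀ f : ℕ → ℕ, u ≠ rename f u')
    (hinst : ∀ x y : ℕ, ∃ φ : ℕ → SWord, (subst φ u).letters.Perm [x, x, y]) {v w : SWord}
    (hv : v ∈ repeatIdeal u) (hw : w ∈ repeatIdeal u) (h : v.content = w.content) : c v w := by
  obtain ⟨q, huq, hq, hqu⟩ := hm.exists_rel_long hu hu' huu' hne
  have hqφ : ∀ φ, (subst φ q).content = (subst φ u).content := fun φ =>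
    fullyInvariant_contentCon φ hqu
  have h₄ : ∀ v : SWord, 4 ≤ v.letters.length → ¬ v.letters.Nodup →
      ∃ v', c v v' ∧ v.content = v'.content ∧ 5 ≤ v'.letters.length ∧ ¬ v'.letters.Nodup := by
    intro v hv hnd
    by_cases hv5 : 5 ≤ v.letters.length
    · exact ⟨v, c.refl v, rfl, hv5, hnd⟩
    obtain ⟨x, l, hl⟩ := exists_perm_of_not_nodup hnd
    have hll := hl.length_eq
    obtain ⟨y, z, rfl⟩ := List.length_eq_two.1 (show l.length = 2 by simp at hll; omega)
    obtain ⟨φ, hφ⟩ := hinst x y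
    have hperm : v.letters.Perm (subst φ u * letter z).letters := by
      rw [letters_mul]
      exact hl.trans (hφ.symm.append_right [z])
    have hcon : v.content = (subst φ q * letter z).content := by
      rw [content_eq_of_perm hperm, content_mul, content_mul, hqφ]
    have hlen : 5 ≤ (subst φ q * letter z).letters.length := by
      have := length_le_subst φ q
      simp only [letters_mul, List.length_append, letters_letter, List.length_singleton]
      omega
    refine ⟨subst φ q * letter z, c.trans (hs.rel_of_perm hv hperm) (c.mul (hc φ huq) (c.refl _)),
      hcon, hlen, fun hnd' => ?_⟩
    have h₁ := length_letters_of_nodup hnd'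
    have h₂ := card_content_le v
    rw [hcon] at h₂
    omega
  have h₃ : ∀ v ∈ repeatIdeal u,
      ∃ v', c v v' ∧ v.content = v'.content ∧ 5 ≤ v'.letters.length ∧ ¬ v'.letters.Nodup := by
    rintro v (⟨hv, hv'⟩ | ⟨φ, rfl⟩)
    · exact h₄ v hv hv'
    by_cases hlen : 4 ≤ (subst φ u).letters.length
    · exact h₄ _ hlen (not_nodup_subst φ hnd)
    have hlq : 4 ≤ (subst φ q).letters.length := hq.trans (length_le_subst φ q)
    obtain ⟨v', h₁, h₂, h₃⟩ := h₄ (subst φ q) hlq fun hnd' => by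
      have h₁ := length_letters_of_nodup hnd'
      have h₂ := card_content_le (subst φ u)
      rw [← hqφ] at h₂
      omega
    exact ⟨v', c.trans (hc φ huq) h₁, (hqφ φ).symm.trans h₂, h₃⟩
  obtain ⟨v', hv₁, hv₂, hv₃, hv₄⟩ := h₃ v hv
  obtain ⟨w', hw₁, hw₂, hw₃, hw₄⟩ := h₃ w hw
  exact c.trans hv₁ (c.trans (hs.rel_of_content_eq_of_five_le
    (fun x y z => hs.rel_square hc hm x y z) hv₃ hv₄ hw₃ hw₄
    (hv₂.symm.trans (h.trans hw₂))) (c.symm hw₁))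

/-- A fully invariant congruence that relates words of equal content from a fully invariant ideal
relates all the words of the ideal, unless it preserves the content. -/
theorem FullyInvariant.rel_of_mem_ideal {c : Con SWord} (hc : FullyInvariant c) {I : Set SWord}
    (hI : IsFIIdeal I) (hrel : ∀ v ∈ I, ∀ w ∈ I, v.content = w.content → c v w) (hσ : ¬ c ≤ contentCon)
    {v w : SWord} (hv : v ∈ I) (hw : w ∈ I) : c v w := by
  obtain ⟨a, b, x, hab, hxa, hxb⟩ : ∃ a b x, c a b ∧ x ∈ a.content ∧ x ∉ b.content := by
    by_contra! H
    refine hσ fun a b hab => ?_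
    exact Finset.Subset.antisymm (fun x => H a b x hab) (fun x => H b a x (c.symm hab))
  have key : ∀ {v w : SWord}, v ∈ I → w ∈ I → c v (w * v) := by
    intro v w hv hw
    -- The image of `a` has the content of `w * v`, that of `b` the content of `v`; hence `c`
    -- relates `v` to `w * v`.
    let φ : ℕ → SWord := fun i => if i = x then w * v else v
    have hφ : c (subst φ a) (subst φ b) := hc φ hab
    have hmem : ∀ d, subst φ d ∈ I := fun d =>
      hI.subst_mem_of_letter d.head_mem_content (by
        simp only [φ]
        split_ifs
        · exact hI.mul_left _ hv
        · exact hv)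
    have hb : (subst φ b).content = v.content := by
      ext z
      rw [mem_content_subst]
      have : ∀ i ∈ b.content, φ i = v := fun i hi => if_neg (by rintro rfl; exact hxb hi)
      constructor
      · rintro ⟨i, hi, hz⟩
        rwa [this i hi] at hz
      · intro hz
        exact ⟨_, b.head_mem_content, by rwa [this _ b.head_mem_content]⟩
    have ha : (subst φ a).content = (w * v).content := by
      ext z
      rw [mem_content_subst]
      constructor
      · rintro ⟨i, -, hz⟩
        simp only [φ] at hz
        split_ifs at hz
        · exact hz
        · rw [content_mul]
          exact Finset.mem_union_right _ hz
      · intro hz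
        exact ⟨x, hxa, by simpa [φ] using hz⟩
    exact c.trans (hrel _ hv _ (hmem b) hb.symm) (c.trans (c.symm hφ)
      (hrel _ (hmem a) _ (hI.mul_left _ hv) ha))
  refine c.trans (key hv hw) (c.trans (hrel _ (hI.mul_left _ hv) _ (hI.mul_left _ hw) ?_)
    (c.symm (key hw hv)))
  rw [content_mul, content_mul, Finset.union_comm]

/-! ### Decomposition of a modular variety. -/

namespace SemigroupVariety

/-- `N` is obtained by collapsing `repeatIdeal u`. If the theory preserves content, the collapse
loses only the content, and SL restores it; otherwise the ideal is already collapsed in `V`. -/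
theorem exists_eq_sup_of_hasSwaps {V : SemigroupVariety.{u}} (hm : IsModularElement V)
    (hs : HasSwaps V.eqTheory) {u u' : SWord} (hu : u.letters.length = 3)
    (hnd : ¬ u.letters.Nodup) (hu' : u'.letters.length = 3) (huu' : V.eqTheory u u')
    (hne : ∀ f : ℕ → ℕ, u ≠ rename f u')
    (hinst : ∀ x y : ℕ, ∃ φ : ℕ → SWord, (subst φ u).letters.Perm [x, x, y]) :
    ∃ M N : SemigroupVariety.{u}, (M = trivialVariety ∨ M = semilatticeVariety) ∧
      N.SatisfiesAll (zeroIdentities u) ∧ N ≤ V ∧ V = M ⊔ N := by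
  have hc := V.fullyInvariant_eqTheory
  rw [isModularElement_iff] at hm
  have hI := isFIIdeal_repeatIdeal hu hnd
  have huI : u ∈ repeatIdeal u := Or.inr ⟨letter, (subst_id u).symm⟩
  have hrel : ∀ v ∈ repeatIdeal u, ∀ w ∈ repeatIdeal u, v.content = w.content →
      V.eqTheory v w :=
    fun v hv w hw h => hs.rel_of_mem_repeatIdeal hc hm hu hnd hu' huu' hne hinst hv hw h
  by_cases hσ : V.eqTheory ≤ contentCon
  · have hfi : FullyInvariant (reesCon hI ⊤) := FullyInvariant.reesCon hI fun _ _ _ _ => trivial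
    have hN : (V ⊓ ofCon (reesCon hI ⊤)).eqTheory = V.eqTheory ⊔ reesCon hI ⊤ := by
      rw [eqTheory_inf, eqTheory_ofCon hfi]
    refine ⟨semilatticeVariety, V ⊓ ofCon (reesCon hI ⊤), Or.inr rfl, ?_, inf_le_left, ?_⟩
    · have key : ∀ v ∈ repeatIdeal u, (V ⊓ ofCon (reesCon hI ⊤)).eqTheory v u := by
        intro v hv
        rw [hN]
        exact (le_sup_right : reesCon hI ⊤ ≤ _) (Or.inr ⟨hv, huI, trivial⟩)
      rintro e ⟨i, -, rfl | rfl⟩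
      · exact key _ (hI.mul_left _ huI)
      · exact key _ (hI.mul_right _ huI)
    · apply eqTheory_injective
      rw [eqTheory_sup, hN, eqTheory_semilatticeVariety]
      refine le_antisymm (le_inf hσ le_sup_left) ?_
      rintro v w ⟨hvw, h⟩
      replace hvw : v.content = w.content := hvw
      -- A chain that really uses the collapse has both its ends equal in `V` to words of the ideal.
      have h' : V.eqTheory v w ∨ ∃ a ∈ repeatIdeal u, ∃ b ∈ repeatIdeal u,
          V.eqTheory v a ∧ V.eqTheory w b := by
        replace h : (V.eqTheory ⊔ reesCon hI ⊤) v w := h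
        rw [Con.sup_rel_iff] at h
        clear hvw
        induction h with
        | refl => exact Or.inl (V.eqTheory.refl _)
        | @tail x y _ hxy ih =>
          rcases hxy with hxy | rfl | ⟨hx, hy, -⟩
          · rcases ih with ih | ⟨a, ha, b, hb, hva, hxb⟩
            · exact Or.inl (V.eqTheory.trans ih hxy)
            · exact Or.inr ⟨a, ha, b, hb, hva, V.eqTheory.trans (V.eqTheory.symm hxy) hxb⟩
          · exact ih
          · rcases ih with ih | ⟨a, ha, b, hb, hva, hxb⟩
            · exact Or.inr ⟨x, hx, y, hy, ih, V.eqTheory.refl _⟩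
            · exact Or.inr ⟨a, ha, y, hy, hva, V.eqTheory.refl _⟩
      rcases h' with h' | ⟨a, ha, b, hb, hva, hwb⟩
      · exact h'
      · have hab : a.content = b.content :=
          (hσ hva : v.content = a.content).symm.trans (hvw.trans (hσ hwb : w.content = b.content))
        exact V.eqTheory.trans hva (V.eqTheory.trans (hrel a ha b hb hab) (V.eqTheory.symm hwb))
  · have hall : ∀ {v w : SWord}, v ∈ repeatIdeal u → w ∈ repeatIdeal u → V.eqTheory v w :=
      fun hv hw => hc.rel_of_mem_ideal hI hrel hσ hv hw
    refine ⟨trivialVariety, V, Or.inl rfl, ?_, le_rfl, ?_⟩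
    · rintro e ⟨i, -, rfl | rfl⟩
      · exact hall (hI.mul_left _ huI) huI
      · exact hall (hI.mul_right _ huI) huI
    · refine (sup_eq_right.2 ?_).symm
      intro S _ hS
      rw [← ofCon_eqTheory V]
      intro e _ φ
      simpa using hS _ rfl fun i =>
        if i = 0 then FreeSemigroup.lift φ e.lhs else FreeSemigroup.lift φ e.rhs

/-- The five nontrivial permutations are the reversal, two mutually inverse rotations and two
adjacent transpositions. Identifying two letters in the identity yields `u ≈ u'` of different
shapes; for the transpositions, modularity supplies the length 4 identity of the system. -/
theorem exists_eq_sup_of_permutational {V : SemigroupVariety.{u}}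
    (hV : ∃ e : SIdentity, e.IsPermutational 3 ∧ V.Satisfies e) (hm : IsModularElement V) :
    ∃ M N : SemigroupVariety.{u}, (M = trivialVariety ∨ M = semilatticeVariety) ∧
      (N.SatisfiesAll identitySystem1 ∨ N.SatisfiesAll identitySystem2 ∨
        N.SatisfiesAll identitySystem3 ∨ N.SatisfiesAll identitySystem4) ∧ V = M ⊔ N := by
  obtain ⟨⟨l, r⟩, ⟨π, hπ, hl, hr⟩, hV⟩ := hV
  have hc := V.fullyInvariant_eqTheory
  have hm' := (isModularElement_iff V).1 hm
  replace hV : V.eqTheory l r := hV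
  replace hl : l.letters = [0, 1, 2] := hl
  obtain rfl : l = letter 0 * (letter 1 * letter 2) := letters_injective hl
  have hcases : ∀ π : Equiv.Perm (Fin 3), π ≠ 1 → List.ofFn (fun i => (π i : ℕ)) ∈
      [[2, 1, 0], [1, 2, 0], [2, 0, 1], [1, 0, 2], [0, 2, 1]] := by decide
  have hr' := hcases π hπ
  rw [← hr] at hr'
  have hword : ∀ {i j k : ℕ}, r.letters = [i, j, k] → ∀ x y z : SWord,
      V.eqTheory (x * (y * z)) (vals x y z x i * (vals x y z x j * vals x y z x k)) := by
    intro i j k hr x y z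
    obtain rfl : r = letter i * (letter j * letter k) := letters_injective hr
    simpa only [map_mul, subst_letter, vals] using hc (vals x y z x) hV
  have hfin : ∀ {P : Set SIdentity} {u : SWord}, (∀ e ∈ P, V.Satisfies e) → ∀ {N},
      N.SatisfiesAll (zeroIdentities u) → N ≤ V → N.SatisfiesAll (P ∪ zeroIdentities u) := by
    rintro P u hP N hN hNV e (he | he)
    · exact fun S _ hS => hP e he S (hNV S hS)
    · exact hN e he
  simp only [List.mem_cons, List.not_mem_nil, or_false] at hr'
  have hrot : (∀ x y z : SWord, V.eqTheory (x * (y * z)) (y * (z * x))) →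
      ∃ M N : SemigroupVariety.{u}, (M = trivialVariety ∨ M = semilatticeVariety) ∧
        (N.SatisfiesAll identitySystem1 ∨ N.SatisfiesAll identitySystem2 ∨
          N.SatisfiesAll identitySystem3 ∨ N.SatisfiesAll identitySystem4) ∧ V = M ⊔ N := by
    intro h
    obtain ⟨M, N, hM, hN, hNV, hV⟩ := exists_eq_sup_of_hasSwaps hm (.of_rotate h)
      (u := letter 0 * letter 0 * letter 1) (u' := letter 0 * (letter 1 * letter 0)) rfl (by decide)
      rfl (h (letter 0) (letter 0) (letter 1))
      (fun f hf => by
        have : [0, 0, 1] = [f 0, f 1, f 0] := congrArg letters hf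
        simp only [List.cons.injEq, and_true] at this
        omega)
      (fun x y => ⟨vals (letter x) (letter y) (letter x) (letter x), .refl _⟩)
    refine ⟨M, N, hM, Or.inr (Or.inl (hfin ?_ hN hNV)), hV⟩
    rintro e rfl
    exact h (letter 0) (letter 1) (letter 2)
  rcases hr' with hr | hr | hr | hr | hr
  · have h : ∀ x y z : SWord, V.eqTheory (x * (y * z)) (z * (y * x)) := hword hr
    obtain ⟨M, N, hM, hN, hNV, hV⟩ := exists_eq_sup_of_hasSwaps hm (.of_reverse h)
      (u := letter 0 * letter 0 * letter 1) (u' := letter 1 * (letter 0 * letter 0)) rfl (by decide)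
      rfl (h (letter 0) (letter 0) (letter 1))
      (fun f hf => by
        have : [0, 0, 1] = [f 1, f 0, f 0] := congrArg letters hf
        simp only [List.cons.injEq, and_true] at this
        omega)
      (fun x y => ⟨vals (letter x) (letter y) (letter x) (letter x), .refl _⟩)
    refine ⟨M, N, hM, Or.inl (hfin ?_ hN hNV), hV⟩
    rintro e rfl
    exact h (letter 0) (letter 1) (letter 2)
  · exact hrot (hword hr)
  · have h : ∀ x y z : SWord, V.eqTheory (x * (y * z)) (z * (x * y)) := hword hr
    exact hrot fun x y z => V.eqTheory.symm (h y z x)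
  · have h : ∀ x y z : SWord, V.eqTheory (x * (y * z)) (y * (x * z)) := hword hr
    have hs := HasSwaps.of_modular_of_swap_left hc hm' h
    obtain ⟨M, N, hM, hN, hNV, hV⟩ := exists_eq_sup_of_hasSwaps hm hs
      (u := letter 0 * letter 1 * letter 1) (u' := letter 1 * (letter 0 * letter 1)) rfl (by decide)
      rfl (h (letter 0) (letter 1) (letter 1))
      (fun f hf => by
        have : [0, 1, 1] = [f 1, f 0, f 1] := congrArg letters hf
        simp only [List.cons.injEq, and_true] at this
        omega)
      (fun x y => ⟨vals (letter y) (letter x) (letter x) (letter x),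
        (List.perm_append_comm : ([y] ++ [x, x]).Perm ([x, x] ++ [y]))⟩)
    refine ⟨M, N, hM, Or.inr (Or.inr (Or.inl (hfin ?_ hN hNV))), hV⟩
    rintro e (rfl | rfl)
    · exact h (letter 0) (letter 1) (letter 2)
    · exact hs.rel_of_perm (by decide) (by decide)
  · have h : ∀ x y z : SWord, V.eqTheory (x * (y * z)) (x * (z * y)) := hword hr
    have hs := HasSwaps.of_modular_of_swap_right hc hm' h
    obtain ⟨M, N, hM, hN, hNV, hV⟩ := exists_eq_sup_of_hasSwaps hm hs
      (u := letter 0 * letter 0 * letter 1) (u' := letter 0 * (letter 1 * letter 0)) rfl (by decide)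
      rfl (h (letter 0) (letter 0) (letter 1))
      (fun f hf => by
        have : [0, 0, 1] = [f 0, f 1, f 0] := congrArg letters hf
        simp only [List.cons.injEq, and_true] at this
        omega)
      (fun x y => ⟨vals (letter x) (letter y) (letter x) (letter x), .refl _⟩)
    refine ⟨M, N, hM, Or.inr (Or.inr (Or.inr (hfin ?_ hN hNV))), hV⟩
    rintro e (rfl | rfl)
    · exact h (letter 0) (letter 1) (letter 2)
    · exact hs.rel_of_perm (by decide) (by decide)

end SemigroupVariety

theorem theorem1 (V : SemigroupVariety.{u})
    (hV : ∃ e : SIdentity, e.IsPermutational 3 ∧ V.Satisfies e) :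
    IsModularElement V ↔
      ∃ M N : SemigroupVariety.{u},
        (M = SemigroupVariety.trivialVariety ∨ M = SemigroupVariety.semilatticeVariety) ∧
        (N.SatisfiesAll identitySystem1 ∨ N.SatisfiesAll identitySystem2 ∨
          N.SatisfiesAll identitySystem3 ∨ N.SatisfiesAll identitySystem4) ∧
        V = M ⊔ N :=
  ⟨SemigroupVariety.exists_eq_sup_of_permutational hV, fun ⟨_, _, hM, hN, h⟩ =>
    SemigroupVariety.isModularElement_of_satisfiesAll hM hN h⟩
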